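/- Work in homotopy type theory (dependent products, dependent pairs, identity types, empty type, unit type, binary sums, natural numbers, W-types, a cumulative hierarchy of universes $\mathcal U_0:\mathcal U_1:\cdots$, function extensionality, univalence and propositional truncation $\|\cdot\|$; no excluded middle, no choice principle and no propositional resizing), extended by the type $\mathsf{Brw}:\mathcal U_0$ of Brouwer ordinals. This is the quotient inductive-inductive type generated, simultaneously with its order $\le\;:\mathsf{Brw}\to\mathsf{Brw}\to\mathcal U_0$, by the following constructors. * For $\mathsf{Brw}$: $\mathsf{zero}:\mathsf{Brw}$; $\mathsf{succ}:\mathsf{Brw}\to\mathsf{Brw}$; $\mathsf{limit}\,f:\mathsf{Brw}$ for every $f:\mathbb N\to\mathsf{Brw}$ with $\mathsf{succ}(f_n)\le f_{n+1}$ for all $n$; an identification $\mathsf{limit}\,f=\mathsf{limit}\,g$ whenever such $f$ and $g$ simulate each other (for every $n$ there exists $m$ with $f_n\le g_m$, and vice versa); and a constructor making $\mathsf{Brw}$ a set. * For $\le$: $\mathsf{zero}\le x$; $x\le y\to y\le z\to x\le z$; $x\le y\to\mathsf{succ}\,x\le\mathsf{succ}\,y$; $x\le f_k\to x\le\mathsf{limit}\,f$;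 $(\forall k.\ f_k\le x)\to\mathsf{limit}\,f\le x$; and a constructor making each $x\le y$ a proposition. For $\alpha:\mathsf{Brw}$, a proposition $P$ (a type with at most one element in a universe $\mathcal U_i$) is called *$\alpha$-decidable* if there exists $y:\mathsf{Brw}$ with $P\leftrightarrow\alpha\le y$, that is, if $\|\Sigma_{y:\mathsf{Brw}}(P\leftrightarrow\alpha\le y)\|$ is inhabited. **Theorem.** For every universe $\mathcal U_i$, homotopy type theory proves: for all $\alpha:\mathsf{Brw}$ and all propositions $P,Q:\mathcal U_i$, if $P$ and $Q$ are $\alpha$-decidable, then so is $P\land Q$. In other words, the closed type $$\prod_{\alpha:\mathsf{Brw}}\ \prod_{P,Q:\mathcal U_i}\mathsf{isProp}(P)\to\mathsf{isProp}(Q)\to(P\ \alpha\text{-decidable})\to(Q\ \alpha\text{-decidable})\to(P\times Q\ \alpha\text{-decidable})$$ has a closed element. -/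

import Mathlib

/-!
A deep embedding of homotopy type theory with the quotient inductive-inductive type `Brw` of
Brouwer ordinals, and the closed type expressing that the `α`-decidable propositions are closed
under binary conjunction.

The type theory is presented by untyped lambda terms over primitive constants, an untyped
convertibility relation (`β`, `η` and the computation rules of the eliminators), and a typing
judgement with a conversion rule and a cumulative hierarchy of Russell universes `U 0 : U 1 : ⋯`.
There is no excluded middle, no choice and no propositional resizing.
-/

namespace HoTT

/-! ## Terms -/

/-- Primitive constants. The natural number arguments are universe levels: the first one is the
level of the type in question and, for eliminators, the last one is the level of the motive. -/
inductive Const : Type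
  /- dependent pairs -/
  | sigma (i : ℕ) | pair (i : ℕ) | sigmaElim (i j : ℕ)
  /- empty type, unit type, coproducts -/
  | empty | emptyElim (j : ℕ)
  | unit | tt | unitElim (j : ℕ)
  | sum (i : ℕ) | inl (i : ℕ) | inr (i : ℕ) | sumElim (i j : ℕ)
  /- natural numbers and W-types -/
  | nat | zero | succ | natElim (j : ℕ)
  | wtype (i : ℕ) | sup (i : ℕ) | wElim (i j : ℕ)
  /- identity types -/
  | idt (i : ℕ) | refl (i : ℕ) | pathElim (i j : ℕ)
  /- function extensionality and univalence -/
  | funext (i : ℕ) | univalence (i : ℕ)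
  /- propositional truncation -/
  | trunc (i : ℕ) | truncIn (i : ℕ) | truncEq (i : ℕ) | truncElim (i j : ℕ)
  /- Brouwer ordinals -/
  | brw | bzero | bsucc | blim | bisim | brwSet
  /- the order on Brouwer ordinals -/
  | le | leZero | leTrans | leSucc | leCocone | leLimiting | leProp
  /- the two mutual eliminators, for ordinals and for inequalities -/
  | brwElim (i : ℕ) | leElim (i : ℕ)

/-- Raw terms, with de Bruijn indices; `pi A B` and `lam b` bind the variable `0` in `B`, `b`. -/
inductive Tm : Type
  | var (n : ℕ)
  | univ (i : ℕ)
  | pi (A B : Tm)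
  | lam (b : Tm)
  | app (f a : Tm)
  | const (c : Const)

namespace Tm

/-- Extend a renaming under a binder. -/
def upRen (ρ : ℕ → ℕ) : ℕ → ℕ
  | 0 => 0
  | n + 1 => ρ n + 1

/-- Renaming of variables. -/
def rename : (ℕ → ℕ) → Tm → Tm
  | ρ, var n => var (ρ n)
  | _, univ i => univ i
  | ρ, pi A B => pi (rename ρ A) (rename (upRen ρ) B)
  | ρ, lam b => lam (rename (upRen ρ) b)
  | ρ, app f a => app (rename ρ f) (rename ρ a)
  | _, const c => const c

/-- Weakening by one variable. -/
def lift (t : Tm) : Tm := rename (fun n => n + 1) t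

/-- Extend a substitution under a binder. -/
def upSubst (σ : ℕ → Tm) : ℕ → Tm
  | 0 => var 0
  | n + 1 => lift (σ n)

/-- Simultaneous substitution. -/
def subst : (ℕ → Tm) → Tm → Tm
  | σ, var n => σ n
  | _, univ i => univ i
  | σ, pi A B => pi (subst σ A) (subst (upSubst σ) B)
  | σ, lam b => lam (subst (upSubst σ) b)
  | σ, app f a => app (subst σ f) (subst σ a)
  | _, const c => const c

/-- The substitution `0 ↦ u`, `n + 1 ↦ n`. -/
def single (u : Tm) : ℕ → Tm
  | 0 => u
  | n + 1 => var n

/-- `inst t u` is `t[u / 0]`. -/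
def inst (t u : Tm) : Tm := subst (single u) t

end Tm

/-- Application of terms is written as juxtaposition. -/
instance : CoeFun Tm (fun _ => Tm → Tm) := ⟨Tm.app⟩
instance : Coe Const Tm := ⟨Tm.const⟩

/-! ## Terms with named variables

`Exp` is a front end for writing terms whose bound variables are Lean variables: an expression
gives a term for every number of enclosing binders, and a bound variable created below `d` binders
becomes the index `d' - d - 1` when it is used below `d'` binders. -/

/-- Terms depending on the number of enclosing binders. -/
structure Exp : Type where
  toTm : ℕ → Tm

namespace Exp

def U (i : ℕ) : Exp := ⟨fun _ => .univ i⟩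
def const (c : Const) : Exp := ⟨fun _ => .const c⟩
def app (f a : Exp) : Exp := ⟨fun d => .app (f.toTm d) (a.toTm d)⟩
/-- The variable bound by a binder that itself lies below `d` binders. -/
def bvar (d : ℕ) : Exp := ⟨fun d' => .var (d' - d - 1)⟩
def lam (b : Exp → Exp) : Exp := ⟨fun d => .lam ((b (bvar d)).toTm (d + 1))⟩
/-- The dependent function type `Π (x : A), B x`. -/
def pi (A : Exp) (B : Exp → Exp) : Exp :=
  ⟨fun d => .pi (A.toTm d) ((B (bvar d)).toTm (d + 1))⟩
/-- The function type `A → B`. -/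
def arrow (A B : Exp) : Exp := pi A fun _ => B
/-- The term denoted by a closed expression. -/
def close (e : Exp) : Tm := e.toTm 0

end Exp

instance : CoeFun Exp (fun _ => Exp → Exp) := ⟨Exp.app⟩
instance : Coe Const Exp := ⟨Exp.const⟩
instance : CoeFun Const (fun _ => Exp → Exp) := ⟨fun c => Exp.app (Exp.const c)⟩

section

open Exp HoTT.Const

local infixr:60 " ⇒ " => Exp.arrow

/-! ## Basic notions of the type theory -/

/-- `A × B` -/
def prod (i : ℕ) (A B : Exp) : Exp := sigma i A (lam fun _ => B)

/-- `A` has at most one element. -/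
def isProp (i : ℕ) (A : Exp) : Exp := pi A fun x => pi A fun y => idt i A x y

/-- The identity types of `A` are propositions. -/
def isSet (i : ℕ) (A : Exp) : Exp := pi A fun x => pi A fun y => isProp i (idt i A x y)

/-- Transport of `u : C x` along `p : x = y`, where `A : U i` and `C : A → U j`. -/
def transport (i j : ℕ) (A C x y p u : Exp) : Exp :=
  pathElim i j A (lam fun x => lam fun y => lam fun _ => C x ⇒ C y) (lam fun _ => lam fun u => u)
    x y p u

/-- `f : A → B` is an equivalence: it has a right inverse and a left inverse. -/
def isEquiv (i : ℕ) (A B f : Exp) : Exp :=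
  prod i
    (sigma i (B ⇒ A) (lam fun g => pi B fun b => idt i B (f (g b)) b))
    (sigma i (B ⇒ A) (lam fun h => pi A fun a => idt i A (h (f a)) a))

/-- The type of equivalences `A ≃ B`. -/
def equiv (i : ℕ) (A B : Exp) : Exp := sigma i (A ⇒ B) (lam fun f => isEquiv i A B f)

/-- The identity function as an element of `A ≃ A`. -/
def idEquiv (i : ℕ) (A : Exp) : Exp :=
  let e := lam fun x => x
  let rinv := pair i (A ⇒ A) (lam fun g => pi A fun b => idt i A (e (g b)) b) e
    (lam fun b => refl i A b)
  let linv := pair i (A ⇒ A) (lam fun h => pi A fun a => idt i A (h (e a)) a) e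
    (lam fun a => refl i A a)
  pair i (A ⇒ A) (lam fun f => isEquiv i A A f) e
    (pair i (sigma i (A ⇒ A) (lam fun g => pi A fun b => idt i A (e (g b)) b))
      (lam fun _ => sigma i (A ⇒ A) (lam fun h => pi A fun a => idt i A (h (e a)) a)) rinv linv)

/-- The canonical function `(A = B) → (A ≃ B)`, for `A B : U i`. -/
def idToEquiv (i : ℕ) (A B : Exp) : Exp :=
  lam fun p => pathElim (i + 1) i (U i) (lam fun A => lam fun B => lam fun _ => equiv i A B)
    (lam fun A => idEquiv i A) A B p

/-- The canonical function `(f = g) → Π (x : A), f x = g x`, for `f g : Π (x : A), B x`. -/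
def happly (i : ℕ) (A B f g : Exp) : Exp :=
  lam fun p => pathElim i i (pi A fun x => B x)
    (lam fun f => lam fun g => lam fun _ => pi A fun x => idt i (B x) (f x) (g x))
    (lam fun f => lam fun x => refl i (B x) (f x)) f g p

/-! ## Brouwer ordinals -/

/-- The sequence `f : ℕ → Brw` is strictly increasing: `f n + 1 ≤ f (n + 1)` for all `n`. -/
def increasing (f : Exp) : Exp := pi nat fun n => le (bsucc (f n)) (f (succ n))

/-- The sequence `f` is simulated by `g`: for every `n` there exists `m` with `f n ≤ g m`. -/
def simulated (f g : Exp) : Exp :=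
  pi nat fun n => trunc 0 (sigma 0 nat (lam fun m => le (f n) (g m)))

/-- The hypotheses of the simultaneous induction principle for `Brw` and `≤`, followed by a
conclusion `K` that may depend on them. The motives are a family of sets `P x` over `x : Brw` and
a family of propositions `Q x y x' y' r` over `r : x ≤ y`, `x' : P x`, `y' : P y`; these two
truncation conditions are the cases of the two truncation constructors. There is one
case for each of the remaining constructors of `Brw` and `≤`. -/
def inductionHyps (i : ℕ)
    (K : (P Q hP hQ z s l b qZero qTrans qSucc qCocone qLimiting : Exp) → Exp) : Exp :=
  pi (brw ⇒ U i) fun P =>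
  pi (pi brw fun x => pi brw fun y => P x ⇒ P y ⇒ le x y ⇒ U i) fun Q =>
  pi (pi brw fun x => isSet i (P x)) fun hP =>
  pi (pi brw fun x => pi brw fun y => pi (P x) fun x' => pi (P y) fun y' => pi (le x y) fun r =>
    isProp i (Q x y x' y' r)) fun hQ =>
  -- zero
  pi (P bzero) fun z =>
  -- successors
  pi (pi brw fun x => P x ⇒ P (bsucc x)) fun s =>
  -- limits
  let increasing' (f hf f' : Exp) : Exp :=
    pi nat fun n => Q (bsucc (f n)) (f (succ n)) (s (f n) (f' n)) (f' (succ n)) (hf n)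
  let sequence (C : (f hf f' hf' : Exp) → Exp) : Exp :=
    pi (nat ⇒ brw) fun f => pi (increasing f) fun hf =>
    pi (pi nat fun n => P (f n)) fun f' => pi (increasing' f hf f') fun hf' => C f hf f' hf'
  pi (sequence fun f hf _ _ => P (blim f hf)) fun l =>
  -- equality of limits of bisimilar sequences
  let simulated' (f g f' g' : Exp) : Exp :=
    pi nat fun n => trunc i (sigma i nat (lam fun m =>
      sigma i (le (f n) (g m)) (lam fun r => Q (f n) (g m) (f' n) (g' m) r)))
  pi (sequence fun f hf f' hf' => sequence fun g hg g' hg' =>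
    pi (simulated f g) fun u => pi (simulated g f) fun v =>
    simulated' f g f' g' ⇒ simulated' g f g' f' ⇒
      idt i (P (blim g hg))
        (transport 0 i brw P (blim f hf) (blim g hg) (bisim f hf g hg u v) (l f hf f' hf'))
        (l g hg g' hg')) fun b =>
  -- minimality of zero
  pi (pi brw fun x => pi (P x) fun x' => Q bzero x z x' (leZero x)) fun qZero =>
  -- transitivity
  pi (pi brw fun x => pi brw fun y => pi brw fun w =>
    pi (P x) fun x' => pi (P y) fun y' => pi (P w) fun w' =>
    pi (le x y) fun r => pi (le y w) fun t => Q x y x' y' r ⇒ Q y w y' w' t ⇒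
      Q x w x' w' (leTrans x y w r t)) fun qTrans =>
  -- monotonicity of the successor
  pi (pi brw fun x => pi brw fun y => pi (P x) fun x' => pi (P y) fun y' =>
    pi (le x y) fun r => Q x y x' y' r ⇒
      Q (bsucc x) (bsucc y) (s x x') (s y y') (leSucc x y r)) fun qSucc =>
  -- limits are upper bounds
  pi (pi brw fun x => pi (P x) fun x' => sequence fun f hf f' hf' => pi nat fun k =>
    pi (le x (f k)) fun r => Q x (f k) x' (f' k) r ⇒
      Q x (blim f hf) x' (l f hf f' hf') (leCocone x f hf k r)) fun qCocone =>
  -- limits are least upper bounds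
  pi (sequence fun f hf f' hf' => pi brw fun x => pi (P x) fun x' =>
    pi (pi nat fun k => le (f k) x) fun r =>
    (pi nat fun k => Q (f k) x (f' k) x' (r k)) ⇒
      Q (blim f hf) x (l f hf f' hf') x' (leLimiting f hf x r)) fun qLimiting =>
  K P Q hP hQ z s l b qZero qTrans qSucc qCocone qLimiting

/-! ## Types of the constants -/

/-- The types of the primitive constants. -/
def constType : Const → Exp
  | .sigma i => pi (U i) fun A => (A ⇒ U i) ⇒ U i
  | .pair i => pi (U i) fun A => pi (A ⇒ U i) fun B => pi A fun a => B a ⇒ sigma i A B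
  | .sigmaElim i j => pi (U i) fun A => pi (A ⇒ U i) fun B => pi (sigma i A B ⇒ U j) fun C =>
      (pi A fun a => pi (B a) fun b => C (pair i A B a b)) ⇒ pi (sigma i A B) fun p => C p
  | .empty => U 0
  | .emptyElim j => pi (empty ⇒ U j) fun C => pi empty fun x => C x
  | .unit => U 0
  | .tt => unit
  | .unitElim j => pi (unit ⇒ U j) fun C => C tt ⇒ pi unit fun x => C x
  | .sum i => U i ⇒ U i ⇒ U i
  | .inl i => pi (U i) fun A => pi (U i) fun B => A ⇒ sum i A B
  | .inr i => pi (U i) fun A => pi (U i) fun B => B ⇒ sum i A B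
  | .sumElim i j => pi (U i) fun A => pi (U i) fun B => pi (sum i A B ⇒ U j) fun C =>
      (pi A fun a => C (inl i A B a)) ⇒ (pi B fun b => C (inr i A B b)) ⇒
      pi (sum i A B) fun x => C x
  | .nat => U 0
  | .zero => nat
  | .succ => nat ⇒ nat
  | .natElim j => pi (nat ⇒ U j) fun C => C zero ⇒ (pi nat fun n => C n ⇒ C (succ n)) ⇒
      pi nat fun n => C n
  | .wtype i => pi (U i) fun A => (A ⇒ U i) ⇒ U i
  | .sup i => pi (U i) fun A => pi (A ⇒ U i) fun B => pi A fun a =>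
      (B a ⇒ wtype i A B) ⇒ wtype i A B
  | .wElim i j => pi (U i) fun A => pi (A ⇒ U i) fun B => pi (wtype i A B ⇒ U j) fun C =>
      (pi A fun a => pi (B a ⇒ wtype i A B) fun f => (pi (B a) fun b => C (f b)) ⇒
        C (sup i A B a f)) ⇒
      pi (wtype i A B) fun w => C w
  | .idt i => pi (U i) fun A => A ⇒ A ⇒ U i
  | .refl i => pi (U i) fun A => pi A fun a => idt i A a a
  | .pathElim i j => pi (U i) fun A =>
      pi (pi A fun x => pi A fun y => idt i A x y ⇒ U j) fun C =>
      (pi A fun x => C x x (refl i A x)) ⇒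
      pi A fun x => pi A fun y => pi (idt i A x y) fun p => C x y p
  | .funext i => pi (U i) fun A => pi (A ⇒ U i) fun B =>
      pi (pi A fun x => B x) fun f => pi (pi A fun x => B x) fun g =>
      isEquiv i (idt i (pi A fun x => B x) f g) (pi A fun x => idt i (B x) (f x) (g x))
        (happly i A B f g)
  | .univalence i => pi (U i) fun A => pi (U i) fun B =>
      isEquiv (i + 1) (idt (i + 1) (U i) A B) (equiv i A B) (idToEquiv i A B)
  | .trunc i => U i ⇒ U i
  | .truncIn i => pi (U i) fun A => A ⇒ trunc i A
  | .truncEq i => pi (U i) fun A => isProp i (trunc i A)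
  | .truncElim i j => pi (U i) fun A => pi (trunc i A ⇒ U j) fun C =>
      (pi (trunc i A) fun t => isProp j (C t)) ⇒ (pi A fun a => C (truncIn i A a)) ⇒
      pi (trunc i A) fun t => C t
  | .brw => U 0
  | .bzero => brw
  | .bsucc => brw ⇒ brw
  | .blim => pi (nat ⇒ brw) fun f => increasing f ⇒ brw
  | .bisim => pi (nat ⇒ brw) fun f => pi (increasing f) fun hf =>
      pi (nat ⇒ brw) fun g => pi (increasing g) fun hg =>
      simulated f g ⇒ simulated g f ⇒ idt 0 brw (blim f hf) (blim g hg)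
  | .brwSet => isSet 0 brw
  | .le => brw ⇒ brw ⇒ U 0
  | .leZero => pi brw fun x => le bzero x
  | .leTrans => pi brw fun x => pi brw fun y => pi brw fun z => le x y ⇒ le y z ⇒ le x z
  | .leSucc => pi brw fun x => pi brw fun y => le x y ⇒ le (bsucc x) (bsucc y)
  | .leCocone => pi brw fun x => pi (nat ⇒ brw) fun f => pi (increasing f) fun hf =>
      pi nat fun k => le x (f k) ⇒ le x (blim f hf)
  | .leLimiting => pi (nat ⇒ brw) fun f => pi (increasing f) fun hf => pi brw fun x =>
      (pi nat fun k => le (f k) x) ⇒ le (blim f hf) x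
  | .leProp => pi brw fun x => pi brw fun y => isProp 0 (le x y)
  | .brwElim i => inductionHyps i fun P _ _ _ _ _ _ _ _ _ _ _ _ => pi brw fun x => P x
  | .leElim i => inductionHyps i fun P Q hP hQ z s l b q₀ q₁ q₂ q₃ q₄ =>
      let ind (x : Exp) : Exp := brwElim i P Q hP hQ z s l b q₀ q₁ q₂ q₃ q₄ x
      pi brw fun x => pi brw fun y => pi (le x y) fun r => Q x y (ind x) (ind y) r

end

/-! ## Convertibility -/

section

open Tm

/-- The computation rules of the eliminators on point constructors. (The eliminator for `≤` takes
values in propositions, so that its computation rules hold up to the identity type anyway.) -/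
inductive Comp : Tm → Tm → Prop
  | sigma (i j : ℕ) (A B C g A' B' a b : Tm) :
      Comp ((const (.sigmaElim i j)) A B C g ((const (.pair i)) A' B' a b)) (g a b)
  | unit (j : ℕ) (C c : Tm) :
      Comp ((const (.unitElim j)) C c (const .tt)) c
  | inl (i j : ℕ) (A B C g h A' B' a : Tm) :
      Comp ((const (.sumElim i j)) A B C g h ((const (.inl i)) A' B' a)) (g a)
  | inr (i j : ℕ) (A B C g h A' B' b : Tm) :
      Comp ((const (.sumElim i j)) A B C g h ((const (.inr i)) A' B' b)) (h b)
  | zero (j : ℕ) (C c g : Tm) :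
      Comp ((const (.natElim j)) C c g (const .zero)) c
  | succ (j : ℕ) (C c g n : Tm) :
      Comp ((const (.natElim j)) C c g ((const .succ) n)) (g n ((const (.natElim j)) C c g n))
  | sup (i j : ℕ) (A B C g A' B' a f : Tm) :
      Comp ((const (.wElim i j)) A B C g ((const (.sup i)) A' B' a f))
        (g a f (lam ((const (.wElim i j)) A.lift B.lift C.lift g.lift (f.lift (var 0)))))
  | refl (i j : ℕ) (A C c x y A' a : Tm) :
      Comp ((const (.pathElim i j)) A C c x y ((const (.refl i)) A' a)) (c a)
  | trunc (i j : ℕ) (A C h g A' a : Tm) :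
      Comp ((const (.truncElim i j)) A C h g ((const (.truncIn i)) A' a)) (g a)
  | bzero (i : ℕ) (P Q hP hQ z s l b q₀ q₁ q₂ q₃ q₄ : Tm) :
      Comp ((const (.brwElim i)) P Q hP hQ z s l b q₀ q₁ q₂ q₃ q₄ (const .bzero)) z
  | bsucc (i : ℕ) (P Q hP hQ z s l b q₀ q₁ q₂ q₃ q₄ x : Tm) :
      Comp ((const (.brwElim i)) P Q hP hQ z s l b q₀ q₁ q₂ q₃ q₄ ((const .bsucc) x))
        (s x ((const (.brwElim i)) P Q hP hQ z s l b q₀ q₁ q₂ q₃ q₄ x))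
  | blim (i : ℕ) (P Q hP hQ z s l b q₀ q₁ q₂ q₃ q₄ f hf : Tm) :
      Comp ((const (.brwElim i)) P Q hP hQ z s l b q₀ q₁ q₂ q₃ q₄ ((const .blim) f hf))
        (l f hf
          (lam ((const (.brwElim i)) P.lift Q.lift hP.lift hQ.lift z.lift s.lift l.lift b.lift
            q₀.lift q₁.lift q₂.lift q₃.lift q₄.lift (f.lift (var 0))))
          (lam ((const (.leElim i)) P.lift Q.lift hP.lift hQ.lift z.lift s.lift l.lift b.lift
            q₀.lift q₁.lift q₂.lift q₃.lift q₄.lift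
            ((const .bsucc) (f.lift (var 0))) (f.lift ((const .succ) (var 0))) (hf.lift (var 0)))))

/-- Judgemental equality, as convertibility of raw terms: the congruence generated by `β`, `η` for
functions and the computation rules. -/
inductive Conv : Tm → Tm → Prop
  | refl (t : Tm) : Conv t t
  | symm {t u : Tm} : Conv t u → Conv u t
  | trans {t u v : Tm} : Conv t u → Conv u v → Conv t v
  | pi {A A' B B' : Tm} : Conv A A' → Conv B B' → Conv (pi A B) (pi A' B')
  | lam {b b' : Tm} : Conv b b' → Conv (lam b) (lam b')
  | app {f f' a a' : Tm} : Conv f f' → Conv a a' → Conv (app f a) (app f' a')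
  | beta (b a : Tm) : Conv (app (lam b) a) (inst b a)
  | eta (f : Tm) : Conv (lam (app f.lift (var 0))) f
  | comp {t u : Tm} : Comp t u → Conv t u

/-! ## Typing -/

/-- `Lookup Γ n A`: the variable `n` has type `A` in the context `Γ` (most recent entry first). -/
inductive Lookup : List Tm → ℕ → Tm → Prop
  | zero (Γ : List Tm) (A : Tm) : Lookup (A :: Γ) 0 A.lift
  | succ {Γ : List Tm} {n : ℕ} {A : Tm} (B : Tm) : Lookup Γ n A → Lookup (B :: Γ) (n + 1) A.lift

/-- `HasType Γ t A`: the typing judgement `Γ ⊢ t : A`. -/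
inductive HasType : List Tm → Tm → Tm → Prop
  | var {Γ : List Tm} {n : ℕ} {A : Tm} : Lookup Γ n A → HasType Γ (var n) A
  | univ (Γ : List Tm) (i : ℕ) : HasType Γ (univ i) (univ (i + 1))
  | cumul {Γ : List Tm} {A : Tm} {i : ℕ} : HasType Γ A (univ i) → HasType Γ A (univ (i + 1))
  | pi {Γ : List Tm} {A B : Tm} {i : ℕ} :
      HasType Γ A (univ i) → HasType (A :: Γ) B (univ i) → HasType Γ (pi A B) (univ i)
  | lam {Γ : List Tm} {A B b : Tm} {i : ℕ} :
      HasType Γ A (univ i) → HasType (A :: Γ) b B → HasType Γ (lam b) (pi A B)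
  | app {Γ : List Tm} {A B f a : Tm} :
      HasType Γ f (pi A B) → HasType Γ a A → HasType Γ (app f a) (inst B a)
  | const (Γ : List Tm) (c : Const) : HasType Γ (const c) (constType c).close
  | conv {Γ : List Tm} {t A B : Tm} {i : ℕ} :
      HasType Γ t A → HasType Γ B (univ i) → Conv A B → HasType Γ t B

/-- A statement of homotopy type theory, given as a closed type, holds if it has a closed
element. -/
def Holds (A : Exp) : Prop := ∃ t : Tm, HasType [] t A.close

end

/-! ## Ordinal decidability -/

section

open Exp HoTT.Const

/-- `P ↔ Q`, for `P Q : U i`. -/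
def iff (i : ℕ) (P Q : Exp) : Exp := prod i (arrow P Q) (arrow Q P)

/-- `∃ (x : A), B x`, the propositional truncation of `Σ (x : A), B x`, where `A : U i`. -/
def exist (i : ℕ) (A : Exp) (B : Exp → Exp) : Exp := trunc i (sigma i A (lam B))

/-- `P : U i` is `α`-decidable: there exists `y : Brw` such that `P ↔ α ≤ y`. -/
def ordDecidable (i : ℕ) (α P : Exp) : Exp := exist i brw fun y => iff i P (le α y)

/-- For all `α : Brw` and all propositions `P`, `Q` in the universe `U i`, if `P` and `Q` are
`α`-decidable, then so is `P ∧ Q`. -/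
def conjunctionClosure (i : ℕ) : Exp :=
  pi brw fun α => pi (U i) fun P => pi (U i) fun Q =>
    arrow (isProp i P) (arrow (isProp i Q)
      (arrow (ordDecidable i α P) (arrow (ordDecidable i α Q) (ordDecidable i α (prod i P Q)))))

end

end HoTT

/-!
An element of the closed type has to be exhibited and shown to be well-typed by the rules of the
type theory. The element is far too large for a typing derivation by hand, so that the proof has
two layers.

**Reflection.** `checker` is a bidirectional type checker for the raw terms, and `checker_sound`
shows that what it accepts is derivable by `HasType`. As conversion is an untyped relation, soundness
needs neither normalization nor subject reduction: where a reduct is used as a type, it is checked to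
be well-formed once more. The checker is run by the kernel on a list of statements with proofs, each
of which may use the previous ones as variables of the context; substituting closed proofs for these
variables (`Realized.extend`) gives a closed element of the last statement. Typing is stable under
strictly monotone maps of universe levels, so that checking the final step for `U 0` and `U 1`
settles it for all `U i`: all of the work on ordinals takes place in `U 0` and `U 1`.

**Ordinals.** By recursion into the set of predicates on `Brw`, the relation `z < y` is defined with
`z < zero` empty, `z < succ x` being `z ≤ x`, and `z < limit f` being `∃ n, z < f n`. It agrees with
`succ z ≤ y`, which yields the inversion principles for the order: nothing of the form `succ x` is
below `zero`, `succ x ≤ succ y` implies `x ≤ y`, and `succ x ≤ limit f` implies `∃ n, succ x ≤ f n`.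
Antisymmetry follows.

Any two ordinals `x`, `y` have a largest limit below both, if it is understood as the supremum of all
limits `h` with `h ≤ x` and `h ≤ y`. The supremum is unique by antisymmetry, so that its existence
is a proposition and can be proved by induction on `x` and `y`. It does not change if a successor is
replaced by its predecessor, and for `limit f` and `limit g` it is the limit of `z n + n`, where
`z n` is the supremum for `f n` and `g n`. An ordinal `w` that is below both `f n` and `g n` is below
some `z j + j` by induction on `w`.

It remains to find, for all `α`, `x`, `y`, some `z` such that `α ≤ z` is equivalent to the
conjunction of `α ≤ x` and `α ≤ y`. This is by induction on `α`. For `zero` it is trivial, and for a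
limit the supremum above serves. For a successor `succ β`, the ordinals `x` and `y` are distinguished:
* if one of them is `zero`, then so is `z`; if both are successors, the predecessors are treated by
  induction;
* if both are limits, the supremum serves, as a limit is above `succ β` only if it is above `β + ω`;
* if `x = succ x'` and `y` is a limit, then `β` is distinguished in turn. If `β = succ γ`, then
  `succ β ≤ y` is equivalent to `β ≤ y`, and the induction hypothesis applies to `β`, `x'` and `y`.
  If `β` is a limit, then `β ≤ x'` is equivalent to `succ β ≤ x' + ω`, and `y` and `x' + ω` are both
  limits.
-/

namespace HoTT

namespace Tm

/-! ### Substitution calculus -/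

theorem upRen_comp (ρ ρ' : ℕ → ℕ) : upRen ρ ∘ upRen ρ' = upRen (ρ ∘ ρ') := by
  funext n; cases n <;> rfl

theorem rename_rename (ρ ρ' : ℕ → ℕ) (t : Tm) :
    rename ρ (rename ρ' t) = rename (ρ ∘ ρ') t := by
  induction t generalizing ρ ρ' with
  | pi A B ihA ihB => simp [rename, ihA, ihB, upRen_comp]
  | lam b ih => simp [rename, ih, upRen_comp]
  | app f a ihf iha => simp [rename, ihf, iha]
  | _ => rfl

theorem upSubst_comp_upRen (σ : ℕ → Tm) (ρ : ℕ → ℕ) :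
    upSubst σ ∘ upRen ρ = upSubst (σ ∘ ρ) := by
  funext n; cases n <;> rfl

theorem subst_rename (σ : ℕ → Tm) (ρ : ℕ → ℕ) (t : Tm) :
    subst σ (rename ρ t) = subst (σ ∘ ρ) t := by
  induction t generalizing σ ρ with
  | pi A B ihA ihB => simp [rename, subst, ihA, ihB, upSubst_comp_upRen]
  | lam b ih => simp [rename, subst, ih, upSubst_comp_upRen]
  | app f a ihf iha => simp [rename, subst, ihf, iha]
  | _ => rfl

theorem rename_upSubst (ρ : ℕ → ℕ) (σ : ℕ → Tm) :
    rename (upRen ρ) ∘ upSubst σ = upSubst (rename ρ ∘ σ) := by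
  funext n
  cases n with
  | zero => rfl
  | succ n => simp only [Function.comp, upSubst, lift, rename_rename]; rfl

theorem rename_subst (ρ : ℕ → ℕ) (σ : ℕ → Tm) (t : Tm) :
    rename ρ (subst σ t) = subst (rename ρ ∘ σ) t := by
  induction t generalizing σ ρ with
  | pi A B ihA ihB => simp [rename, subst, ihA, ihB, rename_upSubst]
  | lam b ih => simp [rename, subst, ih, rename_upSubst]
  | app f a ihf iha => simp [rename, subst, ihf, iha]
  | _ => rfl

theorem lift_subst (σ : ℕ → Tm) (t : Tm) : (subst σ t).lift = subst (upSubst σ) t.lift := by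
  simp only [lift, rename_subst, subst_rename]; rfl

theorem subst_upSubst (σ τ : ℕ → Tm) :
    subst (upSubst σ) ∘ upSubst τ = upSubst (subst σ ∘ τ) := by
  funext n
  cases n with
  | zero => rfl
  | succ n => simp only [Function.comp, upSubst, lift_subst]

theorem subst_subst (σ τ : ℕ → Tm) (t : Tm) :
    subst σ (subst τ t) = subst (subst σ ∘ τ) t := by
  induction t generalizing σ τ with
  | pi A B ihA ihB => simp [subst, ihA, ihB, subst_upSubst]
  | lam b ih => simp [subst, ih, subst_upSubst]
  | app f a ihf iha => simp [subst, ihf, iha]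
  | _ => rfl

theorem upSubst_var : upSubst var = var := by
  funext n; cases n <;> rfl

theorem subst_var (t : Tm) : subst var t = t := by
  induction t with
  | pi A B ihA ihB => simp [subst, upSubst_var, ihA, ihB]
  | lam b ih => simp [subst, upSubst_var, ih]
  | app f a ihf iha => simp [subst, ihf, iha]
  | _ => rfl

theorem rename_eq_subst (ρ : ℕ → ℕ) (t : Tm) : rename ρ t = subst (var ∘ ρ) t := by
  conv_lhs => rw [← subst_var t]
  rw [rename_subst]; rfl

theorem inst_lift (t u : Tm) : inst t.lift u = t := by
  rw [inst, lift, subst_rename]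
  exact subst_var t

theorem subst_inst (σ : ℕ → Tm) (t u : Tm) :
    subst σ (inst t u) = inst (subst (upSubst σ) t) (subst σ u) := by
  simp only [inst, subst_subst]
  congr 1
  funext n
  cases n with
  | zero => rfl
  | succ n => exact (inst_lift _ _).symm

theorem rename_inst (ρ : ℕ → ℕ) (t u : Tm) :
    rename ρ (inst t u) = inst (rename (upRen ρ) t) (rename ρ u) := by
  have h : var ∘ upRen ρ = upSubst (var ∘ ρ) := by funext n; cases n <;> rfl
  simp only [rename_eq_subst, subst_inst, h]

theorem rename_lift (ρ : ℕ → ℕ) (t : Tm) : rename (upRen ρ) t.lift = (rename ρ t).lift := by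
  simp only [lift, rename_rename]; rfl

/-- All free variables of the term are smaller than `k`. -/
def closedBelow : ℕ → Tm → Bool
  | k, var n => Nat.blt n k
  | _, univ _ => true
  | k, pi A B => closedBelow k A && closedBelow (k + 1) B
  | k, lam b => closedBelow (k + 1) b
  | k, app f a => closedBelow k f && closedBelow k a
  | _, const _ => true

theorem subst_of_closedBelow {k : ℕ} {t : Tm} (h : closedBelow k t = true) {σ : ℕ → Tm}
    (hσ : ∀ n < k, σ n = var n) : subst σ t = t := by
  have up {k : ℕ} {σ : ℕ → Tm} (hσ : ∀ n < k, σ n = var n) (n : ℕ) (hn : n < k + 1) :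
      upSubst σ n = var n := by
    cases n with
    | zero => rfl
    | succ n => simp [upSubst, hσ n (by omega), lift, rename]
  induction t generalizing k σ with
  | var n => exact hσ n (by simpa [closedBelow] using h)
  | pi A B ihA ihB =>
    simp only [closedBelow, Bool.and_eq_true] at h
    rw [subst, ihA h.1 hσ, ihB h.2 (up hσ)]
  | lam b ih => rw [subst, ih h (up hσ)]
  | app f a ihf iha =>
    simp only [closedBelow, Bool.and_eq_true] at h
    rw [subst, ihf h.1 hσ, iha h.2 hσ]
  | _ => rfl

end Tm

open Tm

theorem closedBelow_constType (c : Const) : closedBelow 0 (constType c).close = true := by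
  cases c <;> rfl

theorem subst_constType (σ : ℕ → Tm) (c : Const) :
    subst σ (constType c).close = (constType c).close :=
  subst_of_closedBelow (closedBelow_constType c) (fun _ hn => absurd hn (Nat.not_lt_zero _))

theorem rename_constType (ρ : ℕ → ℕ) (c : Const) :
    rename ρ (constType c).close = (constType c).close := by
  rw [rename_eq_subst, subst_constType]

/-! ### Universe levels -/

/-- Replace the universe levels of a constant by their images under `e`. -/
def Const.mapLevel (e : ℕ → ℕ) : Const → Const
  | .sigma i => .sigma (e i) | .pair i => .pair (e i) | .sigmaElim i j => .sigmaElim (e i) (e j)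
  | .emptyElim j => .emptyElim (e j) | .unitElim j => .unitElim (e j)
  | .sum i => .sum (e i) | .inl i => .inl (e i) | .inr i => .inr (e i)
  | .sumElim i j => .sumElim (e i) (e j) | .natElim j => .natElim (e j)
  | .wtype i => .wtype (e i) | .sup i => .sup (e i) | .wElim i j => .wElim (e i) (e j)
  | .idt i => .idt (e i) | .refl i => .refl (e i) | .pathElim i j => .pathElim (e i) (e j)
  | .funext i => .funext (e i) | .univalence i => .univalence (e i)
  | .trunc i => .trunc (e i) | .truncIn i => .truncIn (e i) | .truncEq i => .truncEq (e i)
  | .truncElim i j => .truncElim (e i) (e j)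
  | .brwElim i => .brwElim (e i) | .leElim i => .leElim (e i)
  | c => c

/-- Replace all universe levels in a term by their images under `e`. -/
def Tm.mapLevel (e : ℕ → ℕ) : Tm → Tm
  | var n => var n
  | univ i => univ (e i)
  | pi A B => pi (A.mapLevel e) (B.mapLevel e)
  | lam b => lam (b.mapLevel e)
  | app f a => app (f.mapLevel e) (a.mapLevel e)
  | const c => const (c.mapLevel e)

theorem Const.mapLevel_id (c : Const) : c.mapLevel id = c := by
  cases c <;> rfl

theorem Tm.mapLevel_id (t : Tm) : t.mapLevel id = t := by
  induction t <;> simp_all [Tm.mapLevel, Const.mapLevel_id]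

theorem Tm.mapLevel_rename (e : ℕ → ℕ) (ρ : ℕ → ℕ) (t : Tm) :
    (rename ρ t).mapLevel e = rename ρ (t.mapLevel e) := by
  induction t generalizing ρ <;> simp_all [Tm.mapLevel, rename]

theorem Tm.mapLevel_lift (e : ℕ → ℕ) (t : Tm) : t.lift.mapLevel e = (t.mapLevel e).lift :=
  mapLevel_rename e _ t

theorem Tm.mapLevel_subst (e : ℕ → ℕ) (σ : ℕ → Tm) (t : Tm) :
    (subst σ t).mapLevel e = subst (fun n => (σ n).mapLevel e) (t.mapLevel e) := by
  have up (σ : ℕ → Tm) : (fun n => (upSubst σ n).mapLevel e) =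
      upSubst (fun n => (σ n).mapLevel e) := by
    funext n
    cases n with
    | zero => rfl
    | succ n => exact mapLevel_lift e _
  induction t generalizing σ with
  | pi A B ihA ihB => simp [subst, Tm.mapLevel, ihA, ihB, up]
  | lam b ih => simp [subst, Tm.mapLevel, ih, up]
  | app f a ihf iha => simp [subst, Tm.mapLevel, ihf, iha]
  | _ => rfl

theorem Tm.mapLevel_inst (e : ℕ → ℕ) (t u : Tm) :
    (inst t u).mapLevel e = inst (t.mapLevel e) (u.mapLevel e) := by
  rw [inst, mapLevel_subst, inst]
  congr 1
  funext n; cases n <;> rfl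

/-! ### Stability of convertibility -/

theorem Comp.subst {t u : Tm} (h : Comp t u) (σ : ℕ → Tm) : Comp (t.subst σ) (u.subst σ) := by
  cases h <;> simp only [Tm.subst, ← lift_subst, upSubst] <;> constructor

theorem Comp.mapLevel {t u : Tm} (h : Comp t u) (e : ℕ → ℕ) :
    Comp (t.mapLevel e) (u.mapLevel e) := by
  cases h <;> simp only [Tm.mapLevel, Const.mapLevel, mapLevel_lift] <;> constructor

theorem Conv.subst {t u : Tm} (h : Conv t u) (σ : ℕ → Tm) : Conv (t.subst σ) (u.subst σ) := by
  induction h generalizing σ with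
  | refl t => exact .refl _
  | symm _ ih => exact .symm (ih σ)
  | trans _ _ ih₁ ih₂ => exact .trans (ih₁ σ) (ih₂ σ)
  | pi _ _ ih₁ ih₂ => exact .pi (ih₁ σ) (ih₂ _)
  | lam _ ih => exact .lam (ih _)
  | app _ _ ih₁ ih₂ => exact .app (ih₁ σ) (ih₂ σ)
  | beta b a => rw [subst_inst]; exact .beta _ _
  | eta f =>
    simp only [Tm.subst, ← lift_subst, upSubst]
    exact .eta _
  | comp h => exact .comp (h.subst σ)

theorem Conv.rename {t u : Tm} (h : Conv t u) (ρ : ℕ → ℕ) : Conv (t.rename ρ) (u.rename ρ) := by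
  simpa only [rename_eq_subst] using h.subst (var ∘ ρ)

theorem Conv.mapLevel {t u : Tm} (h : Conv t u) (e : ℕ → ℕ) :
    Conv (t.mapLevel e) (u.mapLevel e) := by
  induction h with
  | refl t => exact .refl _
  | symm _ ih => exact .symm ih
  | trans _ _ ih₁ ih₂ => exact .trans ih₁ ih₂
  | pi _ _ ih₁ ih₂ => exact .pi ih₁ ih₂
  | lam _ ih => exact .lam ih
  | app _ _ ih₁ ih₂ => exact .app ih₁ ih₂
  | beta b a => rw [mapLevel_inst]; exact .beta _ _
  | eta f =>
    simp only [Tm.mapLevel, mapLevel_lift]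
    exact .eta _
  | comp h => exact .comp (h.mapLevel e)

/-! ### Stability of typing -/

/-- The renaming `ρ` maps the variables of `Γ` to variables of `Δ` of the same type. -/
def RenTyped (Δ Γ : List Tm) (ρ : ℕ → ℕ) : Prop :=
  ∀ n A, Lookup Γ n A → Lookup Δ (ρ n) (A.rename ρ)

theorem RenTyped.up {Δ Γ : List Tm} {ρ : ℕ → ℕ} (h : RenTyped Δ Γ ρ) (A : Tm) :
    RenTyped (A.rename ρ :: Δ) (A :: Γ) (upRen ρ) := by
  intro n B hB
  cases hB with
  | zero => rw [rename_lift]; exact .zero _ _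
  | succ _ hB => rw [rename_lift]; exact .succ _ (h _ _ hB)

theorem HasType.rename {Γ Δ : List Tm} {t A : Tm} (h : HasType Γ t A) {ρ : ℕ → ℕ}
    (hρ : RenTyped Δ Γ ρ) : HasType Δ (t.rename ρ) (A.rename ρ) := by
  induction h generalizing Δ ρ with
  | var h => exact .var (hρ _ _ h)
  | univ => exact .univ _ _
  | cumul _ ih => exact .cumul (ih hρ)
  | pi _ _ ih₁ ih₂ => exact .pi (ih₁ hρ) (ih₂ (hρ.up _))
  | lam _ _ ih₁ ih₂ => exact .lam (ih₁ hρ) (ih₂ (hρ.up _))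
  | app _ _ ih₁ ih₂ => rw [rename_inst]; exact .app (ih₁ hρ) (ih₂ hρ)
  | const _ c => rw [rename_constType]; exact .const _ c
  | conv _ _ hc ih₁ ih₂ => exact .conv (ih₁ hρ) (ih₂ hρ) (hc.rename ρ)

theorem HasType.lift {Γ : List Tm} {t A : Tm} (h : HasType Γ t A) (B : Tm) :
    HasType (B :: Γ) t.lift A.lift :=
  h.rename fun _ _ hn => .succ B hn

theorem HasType.weaken_nil {t A : Tm} (h : HasType [] t A) (Γ : List Tm) : HasType Γ t A := by
  have key (ρ : ℕ → ℕ) : HasType Γ (t.rename ρ) (A.rename ρ) := h.rename fun _ _ hn => nomatch hn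
  simpa only [rename_eq_subst, Function.comp_id, subst_var] using key id

/-- The substitution `σ` maps the variables of `Γ` to terms in context `Δ` of the right type. -/
def SubstTyped (Δ Γ : List Tm) (σ : ℕ → Tm) : Prop :=
  ∀ n A, Lookup Γ n A → HasType Δ (σ n) (A.subst σ)

theorem SubstTyped.up {Δ Γ : List Tm} {σ : ℕ → Tm} (h : SubstTyped Δ Γ σ) (A : Tm) :
    SubstTyped (A.subst σ :: Δ) (A :: Γ) (upSubst σ) := by
  intro n B hB
  cases hB with
  | zero => rw [← lift_subst]; exact .var (.zero _ _)
  | succ _ hB => rw [← lift_subst]; exact (h _ _ hB).lift _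

theorem HasType.subst {Γ Δ : List Tm} {t A : Tm} (h : HasType Γ t A) {σ : ℕ → Tm}
    (hσ : SubstTyped Δ Γ σ) : HasType Δ (t.subst σ) (A.subst σ) := by
  induction h generalizing Δ σ with
  | var h => exact hσ _ _ h
  | univ => exact .univ _ _
  | cumul _ ih => exact .cumul (ih hσ)
  | pi _ _ ih₁ ih₂ => exact .pi (ih₁ hσ) (ih₂ (hσ.up _))
  | lam _ _ ih₁ ih₂ => exact .lam (ih₁ hσ) (ih₂ (hσ.up _))
  | app _ _ ih₁ ih₂ => rw [subst_inst]; exact .app (ih₁ hσ) (ih₂ hσ)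
  | const _ c => rw [subst_constType]; exact .const _ c
  | conv _ _ hc ih₁ ih₂ => exact .conv (ih₁ hσ) (ih₂ hσ) (hc.subst σ)

theorem HasType.inst {Γ : List Tm} {t A B u : Tm} (h : HasType (A :: Γ) t B)
    (hu : HasType Γ u A) : HasType Γ (t.inst u) (B.inst u) := by
  refine h.subst fun n C hC => ?_
  cases hC with
  | zero =>
    rw [show A.lift.subst (single u) = A from inst_lift A u]
    exact hu
  | succ _ hC =>
    rw [show ∀ C : Tm, C.lift.subst (single u) = C from fun C => inst_lift C u]
    exact .var hC

theorem HasType.univ_le {Γ : List Tm} {A : Tm} {i j : ℕ} (h : HasType Γ A (Tm.univ i))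
    (hij : i ≤ j) : HasType Γ A (Tm.univ j) := by
  induction hij with
  | refl => exact h
  | step _ ih => exact ih.cumul

/-- The domain and the codomain of a well-formed dependent function type are well-formed. -/
theorem HasType.pi_inv {Γ : List Tm} {A B T : Tm} (h : HasType Γ (Tm.pi A B) T) :
    ∃ i, HasType Γ A (Tm.univ i) ∧ HasType (A :: Γ) B (Tm.univ i) := by
  generalize ht : Tm.pi A B = t at h
  induction h with
  | pi h₁ h₂ =>
    cases ht
    exact ⟨_, h₁, h₂⟩
  | cumul _ ih => exact ih ht
  | conv _ _ _ ih _ => exact ih ht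
  | _ => cases ht

/-! ### A type checker -/

namespace Const

/-- The first universe level of a constant. -/
def level₁ : Const → ℕ
  | sigma i | pair i | sigmaElim i _ | emptyElim i | unitElim i | sum i | inl i | inr i
  | sumElim i _ | natElim i | wtype i | sup i | wElim i _ | idt i | refl i | pathElim i _
  | funext i | univalence i | trunc i | truncIn i | truncEq i | truncElim i _ | brwElim i
  | leElim i => i
  | _ => 0

/-- The second universe level of a constant. -/
def level₂ : Const → ℕ
  | sigmaElim _ j | sumElim _ j | wElim _ j | pathElim _ j | truncElim _ j => j
  | _ => 0

/-- The constant with the given constructor index and universe levels. -/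
def decode (i j : ℕ) : ℕ → Const
  | 0 => sigma i | 1 => pair i | 2 => sigmaElim i j | 3 => empty | 4 => emptyElim i | 5 => unit
  | 6 => tt | 7 => unitElim i | 8 => sum i | 9 => inl i | 10 => inr i | 11 => sumElim i j
  | 12 => nat | 13 => zero | 14 => succ | 15 => natElim i | 16 => wtype i | 17 => sup i
  | 18 => wElim i j | 19 => idt i | 20 => refl i | 21 => pathElim i j | 22 => funext i
  | 23 => univalence i | 24 => trunc i | 25 => truncIn i | 26 => truncEq i | 27 => truncElim i j
  | 28 => brw | 29 => bzero | 30 => bsucc | 31 => blim | 32 => bisim | 33 => brwSet | 34 => le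
  | 35 => leZero | 36 => leTrans | 37 => leSucc | 38 => leCocone | 39 => leLimiting | 40 => leProp
  | 41 => brwElim i | _ => leElim i

theorem decode_code (c : Const) : decode c.level₁ c.level₂ c.ctorIdx = c := by
  cases c <;> rfl

/-- Boolean equality of constants. -/
def beq (c d : Const) : Bool :=
  Nat.beq c.ctorIdx d.ctorIdx && Nat.beq c.level₁ d.level₁ && Nat.beq c.level₂ d.level₂

theorem eq_of_beq {c d : Const} (h : c.beq d = true) : c = d := by
  simp only [beq, Bool.and_eq_true] at h
  rw [← decode_code c, ← decode_code d, Nat.eq_of_beq_eq_true h.1.1,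
    Nat.eq_of_beq_eq_true h.1.2, Nat.eq_of_beq_eq_true h.2]

end Const

namespace Tm

/-- Syntactic equality of terms. -/
def beq : Tm → Tm → Bool
  | var n, u => match u with | var m => Nat.beq n m | _ => false
  | univ i, u => match u with | univ j => Nat.beq i j | _ => false
  | pi A B, u => match u with | pi A' B' => beq A A' && beq B B' | _ => false
  | lam b, u => match u with | lam b' => beq b b' | _ => false
  | app f a, u => match u with | app f' a' => beq a a' && beq f f' | _ => false
  | const c, u => match u with | const d => c.beq d | _ => false

theorem eq_of_beq {t u : Tm} (h : t.beq u = true) : t = u := by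
  induction t generalizing u with
  | var n => cases u <;> simp_all [beq]
  | univ n => cases u <;> simp_all [beq]
  | pi A B ihA ihB =>
    cases u <;> simp [beq] at h
    rw [ihA h.1, ihB h.2]
  | lam b ih =>
    cases u <;> simp [beq] at h
    rw [ih h]
  | app f a ihf iha =>
    cases u <;> simp [beq] at h
    rw [iha h.1, ihf h.2]
  | const c =>
    cases u <;> simp [beq] at h
    rw [Const.eq_of_beq h]

/-- Weakening by `d` variables below `c` binders. -/
def liftBy (d : ℕ) : ℕ → Tm → Tm
  | c, var n => bif Nat.blt n c then var n else var (n + d)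
  | _, univ i => univ i
  | c, pi A B => pi (liftBy d c A) (liftBy d (c + 1) B)
  | c, lam b => lam (liftBy d (c + 1) b)
  | c, app f a => app (liftBy d c f) (liftBy d c a)
  | _, const c => const c

/-- The variable `n` below `k` binders, after the simultaneous instantiation of the variables
`0, 1, …` outside of these binders by the terms in the list. -/
def instVar (k n : ℕ) : ℕ → List Tm → Tm
  | _, [] => var n
  | 0, u :: _ => bif Nat.beq k 0 then u else liftBy k 0 u
  | m + 1, _ :: us => instVar k (n - 1) m us

/-- Simultaneous instantiation of the variables `0, 1, …` by the terms in the list, below `k`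
binders. -/
def instAt (us : List Tm) : ℕ → Tm → Tm
  | k, var n => bif Nat.blt n k then var n else instVar k n (n - k) us
  | _, univ i => univ i
  | k, pi A B => pi (instAt us k A) (instAt us (k + 1) B)
  | k, lam b => lam (instAt us (k + 1) b)
  | k, app f a => app (instAt us k f) (instAt us k a)
  | _, const c => const c

/-- Simultaneous instantiation of the variables `0, 1, …` by the terms in the list. -/
def instList (us : List Tm) (t : Tm) : Tm :=
  match us with
  | [] => t
  | _ => instAt us 0 t

theorem blt_eq_decide (m n : ℕ) : Nat.blt m n = decide (m < n) := by
  rw [Bool.eq_iff_iff, Nat.blt_eq, decide_eq_true_eq]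

theorem upRen_iterate (d c n : ℕ) :
    upRen^[c] (fun n => n + d) n = if n < c then n else n + d := by
  induction c generalizing n with
  | zero => simp
  | succ c ih =>
    rw [Function.iterate_succ_apply']
    cases n with
    | zero => simp [upRen]
    | succ n =>
      simp only [upRen, ih]
      split <;> split <;> omega

theorem liftBy_eq (d c : ℕ) (t : Tm) : liftBy d c t = rename (upRen^[c] (fun n => n + d)) t := by
  induction t generalizing c with
  | var n =>
    simp only [liftBy, rename, upRen_iterate, blt_eq_decide, Bool.cond_decide]
    split <;> rfl
  | pi A B ihA ihB => simp only [liftBy, rename, ihA, ihB, Function.iterate_succ_apply']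
  | lam b ih => simp only [liftBy, rename, ih, Function.iterate_succ_apply']
  | app f a ihf iha => simp only [liftBy, rename, ihf, iha]
  | _ => rfl

theorem liftBy_one (t : Tm) : liftBy 1 0 t = t.lift := liftBy_eq 1 0 t

/-- The substitution of the variables `0, 1, …` by the terms in the list. -/
def substOf : List Tm → ℕ → Tm
  | [], n => var n
  | u :: _, 0 => u
  | _ :: us, n + 1 => substOf us n

theorem liftBy_zero (t : Tm) : liftBy 0 0 t = t := by
  rw [liftBy_eq, rename_eq_subst]
  exact subst_var t

theorem instVar_eq (k n : ℕ) (us : List Tm) :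
    instVar k (n + k) n us = liftBy k 0 (substOf us n) := by
  induction us generalizing n with
  | nil => simp [instVar, substOf, liftBy, blt_eq_decide]
  | cons u us ih =>
    cases n with
    | zero =>
      cases k with
      | zero => exact (liftBy_zero u).symm
      | succ k => rfl
    | succ n =>
      have : n + 1 + k - 1 = n + k := by omega
      rw [instVar, this, ih, substOf]

theorem upSubst_iterate (σ : ℕ → Tm) (k n : ℕ) :
    upSubst^[k] σ n = if n < k then var n else liftBy k 0 (σ (n - k)) := by
  induction k generalizing n with
  | zero => simp [liftBy_zero]
  | succ k ih =>
    rw [Function.iterate_succ_apply']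
    cases n with
    | zero => simp [upSubst]
    | succ n =>
      simp only [upSubst, ih, Nat.add_lt_add_iff_right, Nat.add_sub_add_right]
      split
      · rfl
      · simp only [liftBy_eq, lift, rename_rename]; rfl

theorem instAt_eq (us : List Tm) (k : ℕ) (t : Tm) :
    instAt us k t = subst (upSubst^[k] (substOf us)) t := by
  induction t generalizing k with
  | var n =>
    simp only [instAt, subst, upSubst_iterate, blt_eq_decide, Bool.cond_decide]
    split
    · rfl
    · have h := instVar_eq k (n - k) us
      rwa [Nat.sub_add_cancel (by omega)] at h
  | pi A B ihA ihB => simp only [instAt, subst, ihA, ihB, Function.iterate_succ_apply']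
  | lam b ih => simp only [instAt, subst, ih, Function.iterate_succ_apply']
  | app f a ihf iha => simp only [instAt, subst, ihf, iha]
  | _ => rfl

theorem instList_eq (us : List Tm) (t : Tm) : instList us t = subst (substOf us) t := by
  cases us with
  | nil => exact (subst_var t).symm
  | cons u us => exact instAt_eq (u :: us) 0 t

theorem instList_cons (u : Tm) (us : List Tm) (t : Tm) :
    instList (u :: us) t = inst (subst (upSubst (substOf us)) t) u := by
  rw [instList_eq, inst, subst_subst]
  congr 1
  funext n
  cases n with
  | zero => rfl
  | succ n => exact (inst_lift _ _).symm

theorem instList_single (u t : Tm) : instList [u] t = inst t u := by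
  rw [instList_cons, show substOf [] = var from rfl, upSubst_var, subst_var]

/-- Application of a term to a list of arguments. -/
def apps (f : Tm) (as : List Tm) : Tm := as.foldl app f

/-- The head of an iterated application and its arguments, in front of `as`. -/
def spine : Tm → List Tm → Tm × List Tm
  | app f a, as => spine f (a :: as)
  | f, as => (f, as)

theorem apps_spine {t f : Tm} {as bs : List Tm} (h : spine t as = (f, bs)) :
    apps t as = apps f bs := by
  induction t generalizing as with
  | app g a ihf => exact ihf h
  | _ =>
    simp only [spine, Prod.mk.injEq] at h
    rw [h.1, h.2]

theorem apps_spine_cons {f a g : Tm} {as : List Tm} (h : spine f [a] = (g, as)) :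
    app f a = apps g as :=
  apps_spine h

/-- The term may be the head of a redex. -/
def reducible : Tm → Bool
  | app f _ => reducible f
  | lam _ => true
  | const (.sigmaElim _ _) | const (.pathElim _ _) | const (.natElim _)
  | const (.brwElim _) => true
  | _ => false

/-- The term may have a redex at its head. -/
def headReducible : Tm → Bool
  | app f _ => reducible f
  | _ => false

/-- The computation rules: one step of reduction of the eliminator `c` applied to the arguments
`as`, where `w` computes weak head normal forms. -/
def iota (w : Tm → Tm) (c : Const) (as : List Tm) : Option Tm :=
  match c, as with
  | .sigmaElim i _, _ :: _ :: _ :: g :: m :: as =>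
    match spine (w m) [] with
    | (const (.pair i'), [_, _, a, b]) =>
      bif Nat.beq i i' then some (apps (app (app g a) b) as) else none
    | _ => none
  | .pathElim i _, _ :: _ :: c :: _ :: _ :: m :: as =>
    match spine (w m) [] with
    | (const (.refl i'), [_, a]) => bif Nat.beq i i' then some (apps (app c a) as) else none
    | _ => none
  | .natElim j, C :: c :: g :: m :: as =>
    match spine (w m) [] with
    | (const .zero, []) => some (apps c as)
    | (const .succ, [n]) =>
      some (apps (app (app g n) (apps (const (.natElim j)) [C, c, g, n])) as)
    | _ => none
  | .brwElim i, P :: Q :: hP :: hQ :: z :: s :: l :: b :: q₀ :: q₁ :: q₂ :: q₃ :: q₄ :: m :: as =>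
    match spine (w m) [] with
    | (const .bzero, []) => some (apps z as)
    | (const .bsucc, [x]) =>
      some (apps (app (app s x) (apps (const (.brwElim i))
        [P, Q, hP, hQ, z, s, l, b, q₀, q₁, q₂, q₃, q₄, x])) as)
    | (const .blim, [f, hf]) =>
      let bs := [P, Q, hP, hQ, z, s, l, b, q₀, q₁, q₂, q₃, q₄].map (liftBy 1 0)
      let fn := app (liftBy 1 0 f) (var 0)
      some (apps (apps l [f, hf, lam (app (apps (const (.brwElim i)) bs) fn),
        lam (apps (const (.leElim i)) (bs ++ [app (const .bsucc) fn,
          app (liftBy 1 0 f) (app (const .succ) (var 0)), app (liftBy 1 0 hf) (var 0)]))]) as)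
    | _ => none
  | _, _ => none

/-- The application of `t`, instantiated by the terms in the first list, to those in the second
list, after all `β`-reductions at the head of `t`. -/
def betaApps : Tm → List Tm → List Tm → Tm
  | lam b, us, a :: as => betaApps b (a :: us) as
  | t, us, as => apps (instList us t) as

/-- One layer of the computation of weak head normal forms. -/
def whnfStep (w : Tm → Tm) (t : Tm) : Tm :=
  bif headReducible t then
    match spine t [] with
    | (lam b, as) => w (betaApps (lam b) [] as)
    | (const c, as) =>
      match iota w c as with
      | none => t
      | some r => w r
    | _ => t
  else t

/-- The weak head normal form of a term, up to a bound on the depth of the computation. -/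
def whnf : ℕ → Tm → Tm
  | 0 => id
  | n + 1 => whnfStep (whnf n)

/-- Application of `n` to the arguments of an iterated application. -/
def mapArgs (n : Tm → Tm) : Tm → Tm
  | app f a => app (mapArgs n f) (n a)
  | t => t

/-- One layer of the computation of normal forms. -/
def nfStep (w n : Tm → Tm) (t : Tm) : Tm :=
  match w t with
  | pi A B => pi (n A) (n B)
  | lam b => lam (n b)
  | t => mapArgs n t

/-- The normal form of a term, up to a bound on the depth of the computation. -/
def nf (k : ℕ) : ℕ → Tm → Tm
  | 0 => id
  | n + 1 => nfStep (whnf k) (nf k n)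

/-- Comparison of the heads, and of the arguments by `cv`, of two iterated applications. -/
def spineTest (cv : Tm → Tm → Bool) : Tm → Tm → Bool
  | app f a, app f' a' => bif spineTest cv f f' then cv a a' else false
  | t, u => t.beq u

/-- Comparison of two terms in weak head normal form, where `cv` compares their subterms. -/
def compareTest (cv : Tm → Tm → Bool) (t u : Tm) : Bool :=
  match t, u with
  | pi A B, pi A' B' => bif cv A A' then cv B B' else false
  | lam b, lam b' => cv b b'
  | lam b, u => cv b (app (liftBy 1 0 u) (var 0))
  | t, lam b' => cv (app (liftBy 1 0 t) (var 0)) b'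
  | t, u => spineTest cv t u

/-- One layer of the test of convertibility. Terms with a redex at the head are first compared
syntactically, in order not to unfold them without need. -/
def convStep (w : Tm → Tm) (cv : Tm → Tm → Bool) (t u : Tm) : Bool :=
  bif headReducible t || headReducible u then
    bif t.beq u then true else compareTest cv (w t) (w u)
  else compareTest cv t u

/-- A sound test of convertibility. -/
def convTest (k : ℕ) : ℕ → Tm → Tm → Bool
  | 0 => beq
  | n + 1 => convStep (whnf k) (convTest k n)

end Tm

theorem Conv.apps {f g : Tm} (h : Conv f g) (as : List Tm) : Conv (f.apps as) (g.apps as) := by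
  induction as generalizing f g with
  | nil => exact h
  | cons a as ih => exact ih (h.app (.refl a))

namespace Tm

theorem of_cond {α : Type*} {i j : ℕ} {a b : α}
    (h : (bif Nat.beq i j then some a else none) = some b) : i = j ∧ a = b := by
  cases hij : Nat.beq i j with
  | false => rw [hij] at h; cases h
  | true => rw [hij] at h; cases h; exact ⟨Nat.eq_of_beq_eq_true hij, rfl⟩

theorem conv_iota {w : Tm → Tm} (hw : ∀ t, Conv t (w t)) {c : Const} {as : List Tm} {r : Tm}
    (h : iota w c as = some r) : Conv (apps (const c) as) r := by
  have key {m d : Tm} {bs : List Tm} (hm : spine (w m) [] = (d, bs)) (f : Tm) {r : Tm}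
      (hr : Comp (app f (apps d bs)) r) (as : List Tm) :
      Conv (apps (app f m) as) (apps r as) :=
    ((Conv.app (.refl f) (apps_spine hm ▸ hw m)).trans (.comp hr)).apps as
  unfold iota at h
  split at h
  · split at h
    · next hm =>
      obtain ⟨hi, hr⟩ := of_cond h
      cases hi; cases hr
      exact key hm _ (.sigma ..) _
    · cases h
  · split at h
    · next hm =>
      obtain ⟨hi, hr⟩ := of_cond h
      cases hi; cases hr
      exact key hm _ (.refl ..) _
    · cases h
  · split at h
    · next hm => cases h; exact key hm _ (.zero ..) _
    · next hm => cases h; exact key hm _ (.succ ..) _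
    · cases h
  · split at h
    · next hm => cases h; exact key hm _ (.bzero ..) _
    · next hm => cases h; exact key hm _ (.bsucc ..) _
    · next hm =>
      cases h
      simp only [List.map, liftBy_one]
      exact key hm _ (.blim ..) _
    · cases h
  · cases h

theorem conv_betaApps (t : Tm) (us as : List Tm) :
    Conv (apps (instList us t) as) (betaApps t us as) := by
  induction t generalizing us as with
  | lam b ih =>
    cases as with
    | nil => exact .refl _
    | cons a as =>
      refine Conv.trans (Conv.apps ?_ as) (ih (a :: us) as)
      rw [instList_cons, instList_eq]
      exact .beta _ _
  | _ => exact .refl _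

theorem conv_whnfStep {w : Tm → Tm} (hw : ∀ t, Conv t (w t)) (t : Tm) :
    Conv t (whnfStep w t) := by
  unfold whnfStep
  cases headReducible t with
  | false => exact .refl t
  | true =>
    rw [cond_true]
    split
    · next b as hs =>
      have ht : t = apps (lam b) as := apps_spine hs
      exact ht ▸ (conv_betaApps (lam b) [] as).trans (hw _)
    · next c as hs =>
      have ht : t = apps (const c) as := apps_spine hs
      split
      · exact .refl t
      · next hr => exact (ht ▸ conv_iota hw hr).trans (hw _)
    · exact .refl t

theorem conv_whnf (n : ℕ) (t : Tm) : Conv t (whnf n t) := by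
  induction n generalizing t with
  | zero => exact .refl t
  | succ n ih => exact conv_whnfStep ih t

theorem conv_mapArgs {n : Tm → Tm} (hn : ∀ t, Conv t (n t)) (t : Tm) : Conv t (mapArgs n t) := by
  induction t with
  | app f a ihf => exact .app ihf (hn a)
  | _ => exact .refl _

theorem conv_nf (k n : ℕ) (t : Tm) : Conv t (nf k n t) := by
  induction n generalizing t with
  | zero => exact .refl t
  | succ n ih =>
    refine (conv_whnf k t).trans ?_
    unfold nf nfStep
    split
    · next h => rw [h]; exact .pi (ih _) (ih _)
    · next h => rw [h]; exact .lam (ih _)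
    · exact conv_mapArgs ih _

theorem conv_of_spineTest {cv : Tm → Tm → Bool} (hcv : ∀ t u, cv t u = true → Conv t u)
    {t u : Tm} (h : spineTest cv t u = true) : Conv t u := by
  induction t generalizing u with
  | app f a ihf =>
    cases u with
    | app f' a' =>
      simp only [spineTest, Bool.cond_false_right, Bool.and_eq_true] at h
      exact .app (ihf h.1) (hcv _ _ h.2)
    | _ => exact eq_of_beq h ▸ .refl _
  | _ => exact eq_of_beq h ▸ .refl _

theorem conv_of_compareTest {cv : Tm → Tm → Bool} (hcv : ∀ t u, cv t u = true → Conv t u)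
    {t u : Tm} (h : compareTest cv t u = true) : Conv t u := by
  unfold compareTest at h
  split at h
  · simp only [Bool.cond_false_right, Bool.and_eq_true] at h
    exact .pi (hcv _ _ h.1) (hcv _ _ h.2)
  · exact .lam (hcv _ _ h)
  · rw [liftBy_one] at h
    exact (Conv.lam (hcv _ _ h)).trans (.eta _)
  · rw [liftBy_one] at h
    exact (Conv.eta _).symm.trans (.lam (hcv _ _ h))
  · exact conv_of_spineTest hcv h

theorem conv_of_convTest {k n : ℕ} {t u : Tm} (h : convTest k n t u = true) : Conv t u := by
  induction n generalizing t u with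
  | zero => exact eq_of_beq h ▸ .refl t
  | succ n ih =>
    have hcv (t u : Tm) : convTest k n t u = true → Conv t u := ih
    simp only [convTest, convStep] at h
    cases hr : headReducible t || headReducible u with
    | false =>
      rw [hr, cond_false] at h
      exact conv_of_compareTest hcv h
    | true =>
      rw [hr, cond_true] at h
      cases htu : t.beq u with
      | true => exact eq_of_beq htu ▸ .refl t
      | false =>
        rw [htu, cond_false] at h
        exact (conv_whnf k t).trans ((conv_of_compareTest hcv h).trans (conv_whnf k u).symm)

end Tm

/-- The type of a variable in a context, not yet weakened. -/
def entry : List Tm → ℕ → Option Tm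
  | [], _ => none
  | A :: _, 0 => some A
  | _ :: Γ, n + 1 => entry Γ n

/-- The fuel that bounds the depth of all computations of the type checker. -/
def fuel : ℕ := 100000

/-- Convertibility, or inclusion of universes. -/
def subTest (T T' : Tm) : Bool :=
  bif convTest fuel fuel T T' then true else
    match whnf fuel T, whnf fuel T' with
    | univ i, univ j => Nat.ble i j
    | _, _ => false

/-- One layer of a bidirectional type checker: `ih Γ t none` infers a type of `t`, and
`ih Γ t (some T)` checks `t` against `T`. -/
abbrev Checker : Type := List Tm → Tm → Option Tm → Option Tm

/-- The level of the universe that the type `A` is inferred to belong to. -/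
def sortOf (ih : Checker) (Γ : List Tm) (A : Tm) : Option ℕ :=
  match ih Γ A none with
  | none => none
  | some T =>
    match whnf fuel T with
    | univ i => some i
    | _ => none

/-- The domain and the codomain of a type that reduces to a function type. If it is not literally
one, its normal form is checked to be well-formed, as subject reduction is not available. -/
def asPi (ih : Checker) (Γ : List Tm) (T : Tm) : Option (Tm × Tm) :=
  match T with
  | pi A B => some (A, B)
  | T =>
    match nf fuel fuel T with
    | pi A B =>
      match sortOf ih Γ (pi A B) with
      | some _ => some (A, B)
      | none => none
    | _ => none

/-- The type of the application to the terms in the second list of an element of the type `T`,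
instantiated by the terms in the first list. -/
def inferArgs (ih : Checker) (Γ : List Tm) : Tm → List Tm → List Tm → Option Tm
  | T, us, [] => some (instList us T)
  | pi A B, us, a :: as =>
    match ih Γ a (some (instList us A)) with
    | none => none
    | some _ => inferArgs ih Γ B (a :: us) as
  | T, us, a :: as =>
    match asPi ih Γ (instList us T) with
    | none => none
    | some (A, B) =>
      match ih Γ a (some A) with
      | none => none
      | some _ => inferArgs ih Γ B [a] as

/-- One layer of type inference, where `ok` selects the constants that may be used. -/
def inferStep (ok : Const → Bool) (ih : Checker) (Γ : List Tm) : Tm → Option Tm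
  | var n =>
    match entry Γ n with
    | none => none
    | some A => some (liftBy (n + 1) 0 A)
  | univ i => some (univ (i + 1))
  | pi A B =>
    match sortOf ih Γ A with
    | none => none
    | some i =>
      match sortOf ih (A :: Γ) B with
      | none => none
      | some j => some (univ (bif Nat.ble i j then j else i))
  | lam _ => none
  | app f a =>
    match spine f [a] with
    | (lam b, a :: as) =>
      match ih Γ a none with
      | none => none
      | some A =>
        match ih (A :: Γ) b none with
        | none => none
        | some B => inferArgs ih Γ B [a] as
    | (f, as) =>
      match ih Γ f none with
      | none => none
      | some T => inferArgs ih Γ T [] as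
  | const c => bif ok c then some (constType c).close else none

/-- One layer of type checking. -/
def checkStep (ok : Const → Bool) (ih : Checker) (Γ : List Tm) (t T : Tm) : Option Tm :=
  match t with
  | lam b =>
    match asPi ih Γ T with
    | none => none
    | some (A, B) =>
      match ih (A :: Γ) b (some B) with
      | none => none
      | some _ => some T
  | t =>
    match inferStep ok ih Γ t with
    | none => none
    | some T' => bif subTest T' T then some T else none

/-- The type checker. -/
def checker (ok : Const → Bool) : ℕ → Checker
  | 0, _, _, _ => none
  | n + 1, Γ, t, none => inferStep ok (checker ok n) Γ t
  | n + 1, Γ, t, some T => checkStep ok (checker ok n) Γ t T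

/-! ### Soundness of the type checker -/

/-- Every type in the context is well-formed in the context below it. -/
inductive WfCtx : List Tm → Prop
  | nil : WfCtx []
  | cons {Γ : List Tm} {A : Tm} {i : ℕ} : WfCtx Γ → HasType Γ A (univ i) → WfCtx (A :: Γ)

theorem WfCtx.lookup {Γ : List Tm} (h : WfCtx Γ) {n : ℕ} {A : Tm} (hn : Lookup Γ n A) :
    ∃ i, HasType Γ A (univ i) := by
  induction hn with
  | zero Γ A =>
    cases h with
    | cons _ hA => exact ⟨_, hA.lift A⟩
  | succ B _ ih =>
    cases h with
    | cons h _ =>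
      obtain ⟨i, hi⟩ := ih h
      exact ⟨i, hi.lift B⟩

theorem lookup_of_entry {Γ : List Tm} {n : ℕ} {A : Tm} (h : entry Γ n = some A) :
    Lookup Γ n (liftBy (n + 1) 0 A) := by
  induction Γ generalizing n with
  | nil => cases h
  | cons B Γ ih =>
    cases n with
    | zero => cases h; rw [liftBy_one]; exact .zero Γ A
    | succ n =>
      have : liftBy (n + 1 + 1) 0 A = (liftBy (n + 1) 0 A).lift := by
        simp only [liftBy_eq, Tm.lift, rename_rename]; rfl
      rw [this]
      exact .succ B (ih h)

theorem Lookup.mapLevel {Γ : List Tm} {n : ℕ} {A : Tm} (h : Lookup Γ n A) (e : ℕ → ℕ) :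
    Lookup (Γ.map (Tm.mapLevel e)) n (A.mapLevel e) := by
  induction h with
  | zero => rw [mapLevel_lift]; exact .zero _ _
  | succ _ _ ih => rw [mapLevel_lift]; exact .succ _ ih

/-- After the levels are mapped by `e`, the type of the constant `c` is still the type of a
constant, and it is well-formed. -/
def Admissible (e : ℕ → ℕ) (c : Const) : Prop :=
  (constType c).close.mapLevel e = (constType (c.mapLevel e)).close ∧
    ∃ i, HasType [] (constType (c.mapLevel e)).close (univ i)

/-- Soundness of a checker, after all levels are mapped by `e`. -/
def Checker.Sound (e : ℕ → ℕ) (ih : Checker) : Prop :=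
  ∀ Γ t, WfCtx (Γ.map (Tm.mapLevel e)) →
    (∀ T, ih Γ t none = some T →
      HasType (Γ.map (Tm.mapLevel e)) (t.mapLevel e) (T.mapLevel e) ∧
        ∃ i, HasType (Γ.map (Tm.mapLevel e)) (T.mapLevel e) (univ i)) ∧
    (∀ T T' i, HasType (Γ.map (Tm.mapLevel e)) (T.mapLevel e) (univ i) →
      ih Γ t (some T) = some T' →
        HasType (Γ.map (Tm.mapLevel e)) (t.mapLevel e) (T.mapLevel e))

section Sound

variable {e : ℕ → ℕ} {ih : Checker} {Γ : List Tm}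

theorem hasType_of_sortOf (hih : ih.Sound e) (hΓ : WfCtx (Γ.map (Tm.mapLevel e))) {A : Tm}
    {i : ℕ} (h : sortOf ih Γ A = some i) :
    HasType (Γ.map (Tm.mapLevel e)) (A.mapLevel e) (univ (e i)) := by
  unfold sortOf at h
  split at h
  · cases h
  · next T hT =>
    split at h
    · next j hj =>
      cases h
      have hc := (conv_whnf fuel T).mapLevel e
      rw [hj] at hc
      exact .conv ((hih Γ A hΓ).1 T hT).1 (.univ _ _) hc
    · cases h

theorem wf_of_asPi (hih : ih.Sound e) (hΓ : WfCtx (Γ.map (Tm.mapLevel e))) {T A B : Tm} {i : ℕ}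
    (hT : HasType (Γ.map (Tm.mapLevel e)) (T.mapLevel e) (univ i))
    (h : asPi ih Γ T = some (A, B)) :
    Conv T (pi A B) ∧ ∃ j, HasType (Γ.map (Tm.mapLevel e)) ((pi A B).mapLevel e) (univ j) := by
  unfold asPi at h
  split at h
  · cases h
    exact ⟨.refl _, i, hT⟩
  · split at h
    · next A' B' hw =>
      split at h
      · next j hj =>
        cases h
        exact ⟨hw ▸ conv_nf fuel fuel T, _, hasType_of_sortOf hih hΓ hj⟩
      · cases h
    · cases h

theorem inferArgs_sound (hih : ih.Sound e) (hΓ : WfCtx (Γ.map (Tm.mapLevel e))) {f T R : Tm}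
    {us as : List Tm} {i : ℕ}
    (hf : HasType (Γ.map (Tm.mapLevel e)) (f.mapLevel e) ((instList us T).mapLevel e))
    (hT : HasType (Γ.map (Tm.mapLevel e)) ((instList us T).mapLevel e) (univ i))
    (h : inferArgs ih Γ T us as = some R) :
    HasType (Γ.map (Tm.mapLevel e)) ((apps f as).mapLevel e) (R.mapLevel e) ∧
      ∃ i, HasType (Γ.map (Tm.mapLevel e)) (R.mapLevel e) (univ i) := by
  -- application to one argument
  have key {f a A B R : Tm} {as us : List Tm} {j : ℕ}
      (ih' : ∀ {f T : Tm} {us : List Tm} {i : ℕ},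
        HasType (Γ.map (Tm.mapLevel e)) (f.mapLevel e) ((instList us T).mapLevel e) →
        HasType (Γ.map (Tm.mapLevel e)) ((instList us T).mapLevel e) (univ i) →
        inferArgs ih Γ T us as = some R →
        HasType (Γ.map (Tm.mapLevel e)) ((apps f as).mapLevel e) (R.mapLevel e) ∧
          ∃ i, HasType (Γ.map (Tm.mapLevel e)) (R.mapLevel e) (univ i))
      (hf : HasType (Γ.map (Tm.mapLevel e)) (f.mapLevel e)
        ((pi (instList us A) (subst (upSubst (substOf us)) B)).mapLevel e))
      (hp : HasType (Γ.map (Tm.mapLevel e))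
        ((pi (instList us A) (subst (upSubst (substOf us)) B)).mapLevel e) (univ j))
      {A' : Tm} (ha : ih Γ a (some (instList us A)) = some A')
      (h : inferArgs ih Γ B (a :: us) as = some R) :
      HasType (Γ.map (Tm.mapLevel e)) ((apps (app f a) as).mapLevel e) (R.mapLevel e) ∧
        ∃ i, HasType (Γ.map (Tm.mapLevel e)) (R.mapLevel e) (univ i) := by
    obtain ⟨k, hA, hB⟩ := HasType.pi_inv hp
    have ha := (hih Γ a hΓ).2 _ _ k hA ha
    refine ih' (us := a :: us) (T := B) (i := k) ?_ ?_ h <;> rw [instList_cons, mapLevel_inst]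
    · exact .app hf ha
    · exact hB.inst ha
  induction as generalizing f T us i with
  | nil =>
    cases T <;> (cases h; exact ⟨hf, i, hT⟩)
  | cons a as ih' =>
    unfold inferArgs at h
    split at h
    · next heq => cases heq
    · next A B us a as heq =>
      cases heq
      split at h
      · cases h
      · next ha =>
        rw [instList_eq, subst, ← instList_eq] at hf hT
        exact key ih' hf hT ha h
    · next T us a as _ heq =>
      cases heq
      split at h
      · cases h
      · next A B hAB =>
        split at h
        · cases h
        · next ha =>
          obtain ⟨hc, j, hp⟩ := wf_of_asPi hih hΓ hT hAB
          have hB : subst (upSubst (substOf [])) B = B := by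
            rw [show substOf [] = var from rfl, upSubst_var, subst_var]
          refine key (A := A) (B := B) (us := []) (j := j) ih' ?_ ?_ ha h <;>
            rw [hB, show instList [] A = A from rfl]
          · exact .conv hf hp (hc.mapLevel e)
          · exact hp

theorem inferStep_sound (he : StrictMono e) {ok : Const → Bool}
    (hok : ∀ c, ok c = true → Admissible e c) (hih : ih.Sound e)
    (hΓ : WfCtx (Γ.map (Tm.mapLevel e))) {t T : Tm} (h : inferStep ok ih Γ t = some T) :
    HasType (Γ.map (Tm.mapLevel e)) (t.mapLevel e) (T.mapLevel e) ∧
      ∃ i, HasType (Γ.map (Tm.mapLevel e)) (T.mapLevel e) (univ i) := by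
  unfold inferStep at h
  split at h
  · split at h
    · cases h
    · next hA =>
      cases h
      have hl := (lookup_of_entry hA).mapLevel e
      exact ⟨.var hl, hΓ.lookup hl⟩
  · cases h
    exact ⟨(HasType.univ _ _).univ_le (he (Nat.lt_succ_self _)), _, .univ _ _⟩
  · split at h
    · cases h
    · next i hi =>
      split at h
      · cases h
      · next j hj =>
        cases h
        have hA := hasType_of_sortOf hih hΓ hi
        have hB := hasType_of_sortOf hih (Γ := _ :: Γ) (.cons hΓ hA) hj
        refine ⟨.pi (hA.univ_le (he.monotone ?_)) (hB.univ_le (he.monotone ?_)), _, .univ _ _⟩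
        all_goals
          cases hij : Nat.ble i j
          · have : ¬ i ≤ j := fun h => by rw [Nat.ble_eq_true_of_le h] at hij; cases hij
            simp only [cond_false]; omega
          · have := Nat.le_of_ble_eq_true hij
            simp only [cond_true]; omega
  · cases h
  · split at h
    · next b a as hs =>
      split at h
      · cases h
      · next A hA =>
        split at h
        · cases h
        · next B hB =>
          obtain ⟨ha, i, hA⟩ := (hih Γ a hΓ).1 A hA
          obtain ⟨hb, j, hB⟩ := (hih (A :: Γ) b (.cons hΓ hA)).1 B hB
          have hB : HasType (Γ.map (Tm.mapLevel e)) ((instList [a] B).mapLevel e) (univ j) := by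
            rw [instList_single, mapLevel_inst]; exact hB.inst ha
          have hf : HasType (Γ.map (Tm.mapLevel e)) ((app (lam b) a).mapLevel e)
              ((instList [a] B).mapLevel e) := by
            rw [instList_single, mapLevel_inst]; exact .app (.lam hA hb) ha
          rw [apps_spine_cons hs]
          exact inferArgs_sound (f := app (lam b) a) hih hΓ hf hB h
    · next f' a' f as _ hs =>
      split at h
      · cases h
      · next T' hT' =>
        obtain ⟨hf, i, hT'⟩ := (hih Γ f hΓ).1 T' hT'
        rw [apps_spine_cons hs]
        exact inferArgs_sound (us := []) hih hΓ hf hT' h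
  · next c =>
    cases hc : ok c with
    | false => rw [hc] at h; cases h
    | true =>
      rw [hc] at h
      cases h
      obtain ⟨hc, i, hi⟩ := hok c hc
      rw [hc]
      exact ⟨.const _ _, i, hi.weaken_nil _⟩

theorem checkStep_sound (he : StrictMono e) {ok : Const → Bool}
    (hok : ∀ c, ok c = true → Admissible e c) (hih : ih.Sound e)
    (hΓ : WfCtx (Γ.map (Tm.mapLevel e))) {t T T' : Tm} {i : ℕ}
    (hT : HasType (Γ.map (Tm.mapLevel e)) (T.mapLevel e) (univ i))
    (h : checkStep ok ih Γ t T = some T') :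
    HasType (Γ.map (Tm.mapLevel e)) (t.mapLevel e) (T.mapLevel e) := by
  unfold checkStep at h
  split at h
  · next b =>
    split at h
    · cases h
    · next A B hAB =>
      split at h
      · cases h
      · next hb =>
        obtain ⟨hc, j, hp⟩ := wf_of_asPi hih hΓ hT hAB
        obtain ⟨k, hA, hB⟩ := HasType.pi_inv hp
        have hb := (hih (A :: Γ) b (.cons hΓ hA)).2 B _ k hB hb
        exact .conv (.lam hA hb) hT (hc.mapLevel e).symm
  · split at h
    · cases h
    · next T'' hT'' =>
      have ht := (inferStep_sound he hok hih hΓ hT'').1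
      have hs : subTest T'' T = true := by
        cases hs : subTest T'' T with
        | true => rfl
        | false => rw [hs] at h; cases h
      unfold subTest at hs
      cases hc : convTest fuel fuel T'' T with
      | true => exact .conv ht hT ((conv_of_convTest hc).mapLevel e)
      | false =>
        rw [hc, cond_false] at hs
        split at hs
        · next i' j' hi hj =>
          have h₁ := (conv_whnf fuel T'').mapLevel e
          have h₂ := (conv_whnf fuel T).mapLevel e
          rw [hi] at h₁
          rw [hj] at h₂
          exact .conv ((HasType.conv ht (.univ _ _) h₁).univ_le
            (he.monotone (Nat.le_of_ble_eq_true hs))) hT h₂.symm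
        · cases hs

end Sound

theorem checker_sound {e : ℕ → ℕ} (he : StrictMono e) {ok : Const → Bool}
    (hok : ∀ c, ok c = true → Admissible e c) (n : ℕ) : (checker ok n).Sound e := by
  induction n with
  | zero => exact fun Γ t _ => ⟨fun _ h => (nomatch h), fun _ _ _ _ h => (nomatch h)⟩
  | succ n ih =>
    exact fun Γ t hΓ => ⟨fun T h => inferStep_sound he hok ih hΓ h,
      fun T T' i hT h => checkStep_sound he hok ih hΓ hT h⟩

/-- Membership in a list of constants. -/
def memConst (cs : List Const) (c : Const) : Bool := cs.any c.beq

/-- The types of the constants in the list are well-formed; each of them may use the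
constants that come earlier in the list. -/
def constsTest : List Const → List Const → Bool
  | _, [] => true
  | acc, c :: cs =>
    match sortOf (checker (memConst acc) fuel) [] (constType c).close with
    | none => false
    | some _ => constsTest (c :: acc) cs

theorem admissible_of_mem {e : ℕ → ℕ} {cs : List Const} (h : ∀ c ∈ cs, Admissible e c)
    (c : Const) (hc : memConst cs c = true) : Admissible e c := by
  obtain ⟨d, hd, hcd⟩ := List.any_eq_true.1 hc
  exact Const.eq_of_beq hcd ▸ h d hd

theorem admissible_of_constsTest {e : ℕ → ℕ} (he : StrictMono e) {acc cs : List Const}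
    (hacc : ∀ c ∈ acc, Admissible e c)
    (hcs : ∀ c ∈ cs, (constType c).close.mapLevel e = (constType (c.mapLevel e)).close)
    (h : constsTest acc cs = true) : ∀ c ∈ cs, Admissible e c := by
  induction cs generalizing acc with
  | nil => exact fun _ hc => nomatch hc
  | cons c cs ih =>
    unfold constsTest at h
    split at h
    · cases h
    · next i hi =>
      have hc := hcs c (by simp)
      have hi := hasType_of_sortOf (checker_sound he (admissible_of_mem hacc) fuel) (Γ := []) .nil hi
      rw [hc] at hi
      have hadm : Admissible e c := ⟨hc, _, hi⟩
      refine List.forall_mem_cons.2 ⟨hadm, ih (List.forall_mem_cons.2 ⟨hadm, hacc⟩) ?_ h⟩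
      exact fun d hd => hcs d (by simp [hd])

/-- The context is well-formed and its entries are inhabited by closed terms. -/
def Realized (Γ : List Tm) : Prop := WfCtx Γ ∧ ∃ σ, SubstTyped [] Γ σ

theorem Realized.nil : Realized [] :=
  ⟨.nil, var, fun _ _ h => nomatch h⟩

theorem Realized.cons {Γ : List Tm} {t A : Tm} {i : ℕ} (h : Realized Γ)
    (hA : HasType Γ A (univ i)) (ht : HasType Γ t A) : Realized (A :: Γ) := by
  obtain ⟨hΓ, σ, hσ⟩ := h
  refine ⟨.cons hΓ hA, fun n => n.casesOn (t.subst σ) σ, fun n B hn => ?_⟩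
  cases hn with
  | zero => rw [Tm.lift, subst_rename]; exact ht.subst hσ
  | succ _ hn => rw [Tm.lift, subst_rename]; exact hσ _ _ hn

/-! ### Developments in the type theory -/

/-- A statement of the type theory and its proof. Below the declarations that come before it, the
`k`-th of which is the variable `Exp.bvar k`, these are a type and an element of this type. -/
structure Decl where
  type : Exp
  proof : Exp

/-- The context of the statements in a list of declarations, the most recent one first, on top of
the context `Γ` of length `n`. -/
def extend : ℕ → List Tm → List Decl → List Tm
  | _, Γ, [] => Γ
  | n, Γ, d :: ds => extend (n + 1) (d.type.toTm n :: Γ) ds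

/-- Each declaration in the list has a well-formed statement and a correct proof, on top of the
context `Γ` of length `n`. -/
def declsTest (ok : Const → Bool) : ℕ → List Tm → List Decl → Bool
  | _, _, [] => true
  | n, Γ, d :: ds =>
    match sortOf (checker ok fuel) Γ (d.type.toTm n) with
    | none => false
    | some _ =>
      match checker ok fuel Γ (d.proof.toTm n) (some (d.type.toTm n)) with
      | none => false
      | some _ => declsTest ok (n + 1) (d.type.toTm n :: Γ) ds

theorem map_mapLevel_id (Γ : List Tm) : Γ.map (Tm.mapLevel id) = Γ := by
  rw [show Tm.mapLevel id = id from funext mapLevel_id, List.map_id]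

theorem Realized.extend {ok : Const → Bool} (hok : ∀ c, ok c = true → Admissible id c)
    {n : ℕ} {Γ : List Tm} {ds : List Decl} (hΓ : Realized Γ) (h : declsTest ok n Γ ds = true) :
    Realized (extend n Γ ds) := by
  induction ds generalizing n Γ with
  | nil => exact hΓ
  | cons d ds ih =>
    unfold declsTest at h
    split at h
    · cases h
    · next i hi =>
      split at h
      · cases h
      · next ht =>
        have hΓ' : WfCtx (Γ.map (Tm.mapLevel id)) := by
          rw [map_mapLevel_id]; exact hΓ.1
        have hs := checker_sound strictMono_id hok fuel
        have hA := hasType_of_sortOf hs hΓ' hi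
        have ht := (hs Γ _ hΓ').2 _ _ _ hA ht
        rw [map_mapLevel_id, mapLevel_id] at hA ht
        rw [mapLevel_id] at ht
        exact ih (hΓ.cons hA ht) h

/-! ### Abbreviations for terms -/

/-- Names for the statements of the development that is carried out inside the type theory, in the
order in which they are proved. -/
inductive Lem : Type
  | funExt₀ | funExt₁ | cancelSelf₀ | cancelSelf₁ | hedberg₀ | hedberg₁ | propSet | propPi
  | propSigma | propProd | propIsProp | liftPath | propExt | hPropExt | holdsProp | predExt
  | predSet | impProp | transportConst | limitPredExt | simulatedMap
  | brwInd | leSelf | leSuccSelf | leLimit | succLeOfLimitLe | belowLe | belowSpec | succLeZero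
  | succLeSucc | succLeLimit | leOfSuccLe | limitLeZero | limitLeSucc | succSuccLeLimit
  | simulatedOfLe | eqZero | succNotLimit | antisymm
  | leNext | plusMono | lePlus | plusLeLimit | zeroLeIndex | leIndexLeft | leIndexRight
  | commonProp | meetBound | meetLeast | meetProp | meetZero | meetSucc | meetSymm
  | sumIncreasing | leSum | meetLimits | meet | meetLeLeft | meetLeRight | limitLeMeet | omegaMono | omegaLeLimit | succLeOmega | limitLeOfOmega
  | decIntro | decElim | decSymm | decZeroLeft | decMixed | decSucc | dec

/-- The variable that stands for a proof of the statement. Variables of `Exp` are counted from the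
outermost binder, so that the position of the statement in the list is also its variable, below any
number of later declarations and binders. -/
def Lem.toExp (l : Lem) : Exp := Exp.bvar l.ctorIdx

instance : CoeFun Lem (fun _ => Exp → Exp) := ⟨fun l => Exp.app l.toExp⟩
instance : Coe Lem Exp := ⟨Lem.toExp⟩

section

open Exp HoTT.Const Lem

local infixr:60 " ⇒ " => Exp.arrow

def lam2 (b : Exp → Exp → Exp) : Exp := lam fun x => lam (b x)
def lam3 (b : Exp → Exp → Exp → Exp) : Exp := lam fun x => lam2 (b x)
def lam4 (b : Exp → Exp → Exp → Exp → Exp) : Exp := lam fun x => lam3 (b x)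
def lam5 (b : Exp → Exp → Exp → Exp → Exp → Exp) : Exp := lam fun x => lam4 (b x)
def lam6 (b : Exp → Exp → Exp → Exp → Exp → Exp → Exp) : Exp := lam fun x => lam5 (b x)
def pi2 (A : Exp) (B : Exp → Exp → Exp) : Exp := pi A fun x => pi A (B x)
def pi3 (A : Exp) (B : Exp → Exp → Exp → Exp) : Exp := pi A fun x => pi2 A (B x)

/-- The first component of `p : Σ (x : A), B x`. -/
def fst (i : ℕ) (A B p : Exp) : Exp := sigmaElim i i A B (lam fun _ => A) (lam2 fun a _ => a) p

/-- The second component of `p : Σ (x : A), B x`. -/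
def snd (i : ℕ) (A B p : Exp) : Exp :=
  sigmaElim i i A B (lam fun q => B (fst i A B q)) (lam2 fun _ b => b) p

/-- The first component of `p : A × B`. -/
def prodFst (i : ℕ) (A B p : Exp) : Exp := fst i A (lam fun _ => B) p

/-- The second component of `p : A × B`. -/
def prodSnd (i : ℕ) (A B p : Exp) : Exp :=
  sigmaElim i i A (lam fun _ => B) (lam fun _ => B) (lam2 fun _ b => b) p

/-- The pair `(a, b) : A × B`. -/
def mkProd (i : ℕ) (A B a b : Exp) : Exp := pair i A (lam fun _ => B) a b

/-- The right inverse of `f : A → B` that belongs to a proof `e` that `f` is an equivalence. -/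
def equivInv (i : ℕ) (A B f e : Exp) : Exp :=
  fst i (B ⇒ A) (lam fun g => pi B fun b => idt i B (f (g b)) b)
    (prodFst i (sigma i (B ⇒ A) (lam fun g => pi B fun b => idt i B (f (g b)) b))
      (sigma i (B ⇒ A) (lam fun h => pi A fun a => idt i A (h (f a)) a)) e)

/-- Paths `x = y` and `x = z` give a path `y = z`. -/
def cancel (i : ℕ) (A x y z p q : Exp) : Exp :=
  pathElim i i A (lam3 fun x y _ => idt i A x z ⇒ idt i A y z) (lam2 fun _ q => q) x y p q

/-! ### Propositions and sets -/

/-- Function extensionality, as an implication between pointwise and plain equality. -/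
def funExtDecl (i : ℕ) : Decl where
  type := pi (U i) fun A => pi (A ⇒ U i) fun B => pi2 (pi A fun x => B x) fun f g =>
    (pi A fun x => idt i (B x) (f x) (g x)) ⇒ idt i (pi A fun x => B x) f g
  proof := lam4 fun A B f g =>
    equivInv i (idt i (pi A fun x => B x) f g) (pi A fun x => idt i (B x) (f x) (g x))
      (happly i A B f g) (funext i A B f g)

/-- Cancelling a path against itself gives a reflexivity path. -/
def cancelSelfDecl (i : ℕ) : Decl where
  type := pi (U i) fun A => pi2 A fun x y => pi (idt i A x y) fun r =>
    idt i (idt i A y y) (cancel i A x y y r r) (refl i A y)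
  proof := lam fun A =>
    pathElim i i A (lam3 fun x y r => idt i (idt i A y y) (cancel i A x y y r r) (refl i A y))
      (lam fun x => refl i (idt i A x x) (refl i A x))

/-- A type is a set as soon as it has a reflexive relation, valued in propositions, that implies
equality: the relation yields a constant endomap on each identity type. -/
def hedbergDecl (i : ℕ) (cancelSelf : Lem) : Decl where
  type := pi (U i) fun X => pi (X ⇒ X ⇒ U i) fun R => (pi2 X fun x y => isProp i (R x y)) ⇒
    (pi X fun x => R x x) ⇒ (pi2 X fun x y => R x y ⇒ idt i X x y) ⇒ isSet i X
  proof := lam5 fun X R hR ρ f =>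
    let rel (x y p : Exp) : Exp := transport i i X (R x) x y p (ρ x)
    let g (x y p : Exp) : Exp := f x y (rel x y p)
    let back (x y p : Exp) : Exp := cancel i X x x y (g x x (refl i X x)) p
    let unit (x y p : Exp) : Exp :=
      pathElim i i X (lam3 fun x y p => idt i (idt i X x y) (back x y (g x y p)) p)
        (lam fun x => cancelSelf X x x (g x x (refl i X x))) x y p
    lam4 fun x y p q =>
      pathElim i i (R x y)
        (lam3 fun r s _ => idt i (idt i X x y) (back x y (f x y r)) p ⇒
          idt i (idt i X x y) (back x y (f x y s)) q ⇒ idt i (idt i X x y) p q)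
        (lam fun r => lam2 fun c d => cancel i (idt i X x y) (back x y (f x y r)) p q c d)
        (rel x y p) (rel x y q) (hR x y (rel x y p) (rel x y q)) (unit x y p) (unit x y q)

/-- The type of propositions in `U 0`. -/
def hProp : Exp := sigma 1 (U 0) (lam fun A => isProp 0 A)

/-- The proposition `A`, with the proof `h` that it is one. -/
def mkHProp (A h : Exp) : Exp := pair 1 (U 0) (lam fun A => isProp 0 A) A h

/-- The underlying type of an element of `hProp`. -/
def holds (a : Exp) : Exp := fst 1 (U 0) (lam fun A => isProp 0 A) a

/-- Predicates on Brouwer ordinals. -/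
def pred : Exp := brw ⇒ hProp

/-- Logical equivalence of `A` and `B` in `U 0`. -/
def iff₀ (A B : Exp) : Exp := prod 0 (A ⇒ B) (B ⇒ A)

/-- The predicates `D` and `E` are equivalent. -/
def predEquiv (D E : Exp) : Exp := pi brw fun z => iff₀ (holds (D z)) (holds (E z))

/-- The predicate `D` implies the predicate `E`. -/
def predImp (D E : Exp) : Exp := pi brw fun z => holds (D z) ⇒ holds (E z)

/-- `∃ n, B n`, over the natural numbers. -/
def ex (B : Exp → Exp) : Exp := trunc 0 (sigma 0 nat (lam B))

/-- The element of `∃ n, B n` given by `n` and `b : B n`. -/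
def exIntro (B : Exp → Exp) (n b : Exp) : Exp :=
  truncIn 0 (sigma 0 nat (lam B)) (pair 0 nat (lam B) n b)

/-- Elimination of `t : ∃ n, B n` into a proposition `G`, where `h : isProp G`. -/
def exElim (B : Exp → Exp) (G h t : Exp) (k : Exp → Exp → Exp) : Exp :=
  truncElim 0 0 (sigma 0 nat (lam B)) (lam fun _ => G) (lam fun _ => h)
    (lam fun s => sigmaElim 0 0 nat (lam B) (lam fun _ => G) (lam2 k) s) t

/-- The union of a sequence of predicates. -/
def limitPred (F : Exp) : Exp :=
  lam fun z => mkHProp (ex fun n => holds (F n z))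
    (truncEq 0 (sigma 0 nat (lam fun n => holds (F n z))))

/-- Each `f n` is at most some `g m` such that the predicate `F n` implies `G m`. This is what the
eliminator of `brw` provides for sequences that simulate each other. -/
def simulatedPred (f g F G : Exp) : Exp :=
  pi nat fun n => trunc 1 (sigma 1 nat (lam fun m => sigma 1 (le (f n) (g m)) (lam fun _ =>
    predImp (F n) (G m))))

/-- Facts on propositions, sets and predicates, each preceded by its name in `Lem`. -/
def logicDecls : List Decl := [
  -- funExt₀, funExt₁
  funExtDecl 0, funExtDecl 1,
  -- cancelSelf₀, cancelSelf₁
  cancelSelfDecl 0, cancelSelfDecl 1,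
  -- hedberg₀, hedberg₁
  hedbergDecl 0 cancelSelf₀, hedbergDecl 1 cancelSelf₁,
  -- propSet
  ⟨pi (U 0) fun A => isProp 0 A ⇒ isSet 0 A,
    lam2 fun A h => hedberg₀ A (lam2 fun _ _ => A) (lam2 fun _ _ => h) (lam fun x => x)
      (lam3 fun x y _ => h x y)⟩,
  -- propPi
  ⟨pi (U 0) fun A => pi (A ⇒ U 0) fun B => (pi A fun x => isProp 0 (B x)) ⇒
      isProp 0 (pi A fun x => B x),
    lam5 fun A B h f g => funExt₀ A B f g (lam fun x => h x (f x) (g x))⟩,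
  -- propSigma
  ⟨pi (U 0) fun A => pi (A ⇒ U 0) fun B => (pi A fun x => isProp 0 (B x)) ⇒
      (pi2 A fun x y => B x ⇒ B y ⇒ idt 0 A x y) ⇒ isProp 0 (sigma 0 A B),
    lam6 fun A B hB hA p q =>
      let path (x b y c : Exp) : Exp := idt 0 (sigma 0 A B) (pair 0 A B x b) (pair 0 A B y c)
      sigmaElim 0 0 A B (lam fun p => idt 0 (sigma 0 A B) p q)
        (lam2 fun x b => sigmaElim 0 0 A B (lam fun q => idt 0 (sigma 0 A B) (pair 0 A B x b) q)
          (lam2 fun y c =>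
            pathElim 0 0 A (lam3 fun x y _ => pi (B x) fun b => pi (B y) fun c => path x b y c)
              (lam3 fun x b c => pathElim 0 0 (B x) (lam3 fun b c _ => path x b x c)
                (lam fun b => refl 0 (sigma 0 A B) (pair 0 A B x b)) b c (hB x b c))
              x y (hA x y b c) b c) q) p⟩,
  -- propProd
  ⟨pi2 (U 0) fun A B => isProp 0 A ⇒ isProp 0 B ⇒ isProp 0 (prod 0 A B),
    lam4 fun A B hA hB => propSigma A (lam fun _ => B) (lam fun _ => hB)
      (lam4 fun x y _ _ => hA x y)⟩,
  -- propIsProp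
  ⟨pi (U 0) fun A => isProp 0 (isProp 0 A),
    lam3 fun A h h' => propPi A (lam fun x => pi A fun y => idt 0 A x y)
      (lam fun x => propPi A (lam fun y => idt 0 A x y) (lam fun y => propSet A h x y)) h h'⟩,
  -- liftPath
  ⟨pi (U 0) fun A => pi2 A fun x y => idt 0 A x y ⇒ idt 1 A x y,
    lam4 fun A x y p => pathElim 0 1 A (lam3 fun x y _ => idt 1 A x y) (lam fun x => refl 1 A x)
      x y p⟩,
  -- propExt
  ⟨pi2 (U 0) fun A B => isProp 0 A ⇒ isProp 0 B ⇒ (A ⇒ B) ⇒ (B ⇒ A) ⇒ idt 1 (U 0) A B,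
    lam6 fun A B hA hB f g =>
      let rinv := pair 0 (B ⇒ A) (lam fun g => pi B fun b => idt 0 B (f (g b)) b) g
        (lam fun b => hB (f (g b)) b)
      let linv := pair 0 (B ⇒ A) (lam fun h => pi A fun a => idt 0 A (h (f a)) a) g
        (lam fun a => hA (g (f a)) a)
      equivInv 1 (idt 1 (U 0) A B) (equiv 0 A B) (idToEquiv 0 A B) (univalence 0 A B)
        (pair 0 (A ⇒ B) (lam fun f => isEquiv 0 A B f) f
          (mkProd 0 (sigma 0 (B ⇒ A) (lam fun g => pi B fun b => idt 0 B (f (g b)) b))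
            (sigma 0 (B ⇒ A) (lam fun h => pi A fun a => idt 0 A (h (f a)) a)) rinv linv))⟩,
  -- hPropExt
  ⟨pi2 hProp fun a b => (holds a ⇒ holds b) ⇒ (holds b ⇒ holds a) ⇒ idt 1 hProp a b,
    lam2 fun a b =>
      let goal (a b : Exp) : Exp := (holds a ⇒ holds b) ⇒ (holds b ⇒ holds a) ⇒ idt 1 hProp a b
      let elim (C : Exp → Exp) (k : Exp → Exp → Exp) (a : Exp) : Exp :=
        sigmaElim 1 1 (U 0) (lam fun A => isProp 0 A) (lam C) (lam2 k) a
      elim (fun a => goal a b) (fun A hA => elim (fun b => goal (mkHProp A hA) b)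
        (fun B hB => lam2 fun f g =>
          pathElim 1 1 (U 0) (lam3 fun A B _ => pi (isProp 0 A) fun hA => pi (isProp 0 B) fun hB =>
              idt 1 hProp (mkHProp A hA) (mkHProp B hB))
            (lam3 fun A h h' => pathElim 0 1 (isProp 0 A)
              (lam3 fun h h' _ => idt 1 hProp (mkHProp A h) (mkHProp A h'))
              (lam fun h => refl 1 hProp (mkHProp A h)) h h' (propIsProp A h h'))
            A B (propExt A B hA hB f g) hA hB) b) a⟩,
  -- holdsProp
  ⟨pi hProp fun a => isProp 0 (holds a), lam fun a => snd 1 (U 0) (lam fun A => isProp 0 A) a⟩,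
  -- predExt
  ⟨pi2 pred fun D E => predEquiv D E ⇒ idt 1 pred D E,
    lam3 fun D E h => funExt₁ brw (lam fun _ => hProp) D E (lam fun z =>
      hPropExt (D z) (E z)
        (prodFst 0 (holds (D z) ⇒ holds (E z)) (holds (E z) ⇒ holds (D z)) (h z))
        (prodSnd 0 (holds (D z) ⇒ holds (E z)) (holds (E z) ⇒ holds (D z)) (h z)))⟩,
  -- predSet
  ⟨isSet 1 pred,
    hedberg₁ pred (lam2 fun D E => predEquiv D E)
      (lam2 fun D E => lam2 fun u v => liftPath (predEquiv D E) u v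
        (propPi brw (lam fun z => iff₀ (holds (D z)) (holds (E z)))
          (lam fun z => propProd (holds (D z) ⇒ holds (E z)) (holds (E z) ⇒ holds (D z))
            (propPi (holds (D z)) (lam fun _ => holds (E z)) (lam fun _ => holdsProp (E z)))
            (propPi (holds (E z)) (lam fun _ => holds (D z)) (lam fun _ => holdsProp (D z))))
          u v))
      (lam2 fun D z => mkProd 0 (holds (D z) ⇒ holds (D z)) (holds (D z) ⇒ holds (D z))
        (lam fun x => x) (lam fun x => x))
      predExt⟩,
  -- impProp
  ⟨pi2 pred fun D E => isProp 1 (predImp D E),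
    lam4 fun D E u v => liftPath (predImp D E) u v
      (propPi brw (lam fun z => holds (D z) ⇒ holds (E z))
        (lam fun z => propPi (holds (D z)) (lam fun _ => holds (E z))
          (lam fun _ => holdsProp (E z))) u v)⟩,
  -- transportConst
  ⟨pi (U 1) fun X => pi2 brw fun x y => pi (idt 0 brw x y) fun p => pi2 X fun u v =>
      idt 1 X u v ⇒ idt 1 X (transport 0 1 brw (lam fun _ => X) x y p u) v,
    lam fun X => pathElim 0 1 brw
      (lam3 fun x y p => pi2 X fun u v =>
        idt 1 X u v ⇒ idt 1 X (transport 0 1 brw (lam fun _ => X) x y p u) v)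
      (lam4 fun _ _ _ e => e)⟩,
  -- limitPredExt
  ⟨pi2 (nat ⇒ pred) fun F G => predImp (limitPred F) (limitPred G) ⇒
      predImp (limitPred G) (limitPred F) ⇒ idt 1 pred (limitPred F) (limitPred G),
    lam4 fun F G u v => predExt (limitPred F) (limitPred G) (lam fun z =>
      mkProd 0 (holds (limitPred F z) ⇒ holds (limitPred G z))
        (holds (limitPred G z) ⇒ holds (limitPred F z)) (u z) (v z))⟩,
  -- simulatedMap
  ⟨pi2 (nat ⇒ brw) fun f g => pi2 (nat ⇒ pred) fun F G =>
      simulatedPred f g F G ⇒ predImp (limitPred F) (limitPred G),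
    lam4 fun f g F G => lam3 fun u z t =>
      let goal := ex fun m => holds (G m z)
      let goalProp := truncEq 0 (sigma 0 nat (lam fun m => holds (G m z)))
      let fiber (n : Exp) : Exp := lam fun m => sigma 1 (le (f n) (g m)) (lam fun _ =>
        predImp (F n) (G m))
      exElim (fun n => holds (F n z)) goal goalProp t fun n w =>
        truncElim 1 0 (sigma 1 nat (fiber n)) (lam fun _ => goal) (lam fun _ => goalProp)
          (lam fun s => sigmaElim 1 0 nat (fiber n) (lam fun _ => goal)
            (lam2 fun m p => sigmaElim 1 0 (le (f n) (g m)) (lam fun _ => predImp (F n) (G m))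
              (lam fun _ => goal)
              (lam2 fun _ q => exIntro (fun m => holds (G m z)) m (q z w)) p) s) (u n)⟩]

end

section

open Exp HoTT.Const Lem

local infixr:60 " ⇒ " => Exp.arrow

/-! ### Induction and inversion for Brouwer ordinals -/

/-- The arguments of the eliminators that define, by recursion on `y`, the predicate `z < y`, and
that show simultaneously, by recursion on the order, that it is monotone in `y`. The recursion is
valued in `pred`, where univalence for propositions turns the logical equivalence of the unions over
two sequences that simulate each other into the equality that the eliminator asks for. -/
def withCode (K : (P Q hP hQ z s l b qZero qTrans qSucc qCocone qLimiting : Exp) → Exp) : Exp :=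
  K (lam fun _ => pred) (lam5 fun _ _ D E _ => predImp D E)
    (lam fun _ => predSet) (lam5 fun _ _ D E _ => impProp D E)
    -- no ordinal is below zero
    (lam fun _ => mkHProp empty (lam2 fun x y => emptyElim 0 (lam fun _ => idt 0 empty x y) x))
    -- the ordinals below a successor
    (lam3 fun x _ z => mkHProp (le z x) (leProp z x))
    -- the ordinals below a limit
    (lam4 fun _ _ F _ => limitPred F)
    (lam4 fun f hf F _ => lam4 fun g hg G _ => lam4 fun u v u' v' =>
      transportConst pred (blim f hf) (blim g hg) (bisim f hf g hg u v) (limitPred F) (limitPred G)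
        (limitPredExt F G (simulatedMap f g F G u') (simulatedMap g f G F v')))
    (lam4 fun _ E z e => emptyElim 0 (lam fun _ => holds (E z)) e)
    (lam6 fun _ _ _ _ _ _ => lam4 fun _ _ q q' => lam2 fun z e => q' z (q z e))
    (lam6 fun x y _ _ r _ => lam2 fun z e => leTrans z x y e r)
    (lam6 fun _ _ _ _ F _ => lam3 fun k _ q => lam2 fun z e =>
      exIntro (fun n => holds (F n z)) k (q z e))
    (lam6 fun _ _ F _ _ E => lam4 fun _ q z e =>
      exElim (fun n => holds (F n z)) (holds (E z)) (holdsProp (E z)) e (fun n w => q n z w))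

/-- The proposition `z < y`. -/
def below (y z : Exp) : Exp :=
  holds (withCode (fun P Q hP hQ z s l b q₀ q₁ q₂ q₃ q₄ =>
    brwElim 1 P Q hP hQ z s l b q₀ q₁ q₂ q₃ q₄ y) z)

/-- The proof of `z < y` that is given by `r : x ≤ y` and `e : z < x`. -/
def belowOfLe (x y r z e : Exp) : Exp :=
  withCode (fun P Q hP hQ z s l b q₀ q₁ q₂ q₃ q₄ =>
    leElim 1 P Q hP hQ z s l b q₀ q₁ q₂ q₃ q₄ x y r) z e

/-- The quantification over all strictly increasing sequences and the proofs that they are. -/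
def piSeq (B : Exp → Exp → Exp) : Exp := pi (nat ⇒ brw) fun f => pi (increasing f) fun hf => B f hf

/-- No ordinal is related to zero by `c`. -/
def belowZero (c : Exp) : Exp := pi brw fun z => c bzero z ⇒ empty

/-- The ordinals that are related to a successor by `c` are at most its predecessor. -/
def belowSucc (c : Exp) : Exp := pi2 brw fun y z => c (bsucc y) z ⇒ le z y

/-- An ordinal that is related to a limit by `c` is related to an element of the sequence. -/
def belowLimit (c : Exp) : Exp :=
  piSeq fun f hf => pi brw fun z => c (blim f hf) z ⇒ ex fun n => c (f n) z

/-- A proof of `x ≤ z` from `p : x ≤ y` and `q : y ≤ z`. -/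
def tr (x y z p q : Exp) : Exp := leTrans x y z p q

/-- The sum of an ordinal `x` and a natural number `n`. -/
def plus (x n : Exp) : Exp := natElim 0 (lam fun _ => brw) x (lam2 fun _ y => bsucc y) n

/-- The principle of induction for families of propositions over the Brouwer ordinals. -/
def brwIndDecl : Decl where
  type := pi (brw ⇒ U 0) fun P => (pi brw fun x => isProp 0 (P x)) ⇒ P bzero ⇒
    (pi brw fun x => P x ⇒ P (bsucc x)) ⇒
    (piSeq fun f hf => (pi nat fun n => P (f n)) ⇒ P (blim f hf)) ⇒ pi brw fun x => P x
  proof := lam6 fun P hP z s l x =>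
    -- the family over the order is a trivial one, consisting of inhabited propositions
    let trivial := le bzero bzero
    let proof := leZero bzero
    let trivialProp := leProp bzero bzero
    brwElim 0 P (lam5 fun _ _ _ _ _ => trivial) (lam fun x => propSet (P x) (hP x))
      (lam5 fun _ _ _ _ _ => trivialProp) z s (lam4 fun f hf h _ => l f hf h)
      (lam4 fun f hf h _ => lam4 fun g hg k _ => lam4 fun u v _ _ =>
        hP (blim g hg)
          (transport 0 0 brw P (blim f hf) (blim g hg) (bisim f hf g hg u v) (l f hf h)) (l g hg k))
      (lam2 fun _ _ => proof) (lam6 fun _ _ _ _ _ _ => lam4 fun _ _ _ _ => proof)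
      (lam6 fun _ _ _ _ _ _ => proof)
      (lam6 fun _ _ _ _ _ _ => lam3 fun _ _ _ => proof)
      (lam6 fun _ _ _ _ _ _ => lam2 fun _ _ => proof) x

/-- Inversion and antisymmetry of the order of Brouwer ordinals. Each statement is preceded by its
name in `Lem`. -/
def orderDecls : List Decl := [
  -- brwInd
  brwIndDecl,
  -- leSelf
  ⟨pi brw fun x => le x x,
    brwInd (lam fun x => le x x) (lam fun x => leProp x x) (leZero bzero)
      (lam2 fun x h => leSucc x x h)
      (lam3 fun f hf h => leLimiting f hf (blim f hf) (lam fun k => leCocone (f k) f hf k (h k)))⟩,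
  -- leSuccSelf
  ⟨pi brw fun x => le x (bsucc x),
    brwInd (lam fun x => le x (bsucc x)) (lam fun x => leProp x (bsucc x)) (leZero (bsucc bzero))
      (lam2 fun x h => leSucc x (bsucc x) h)
      (lam3 fun f hf h => leLimiting f hf (bsucc (blim f hf)) (lam fun k =>
        tr (f k) (bsucc (f k)) (bsucc (blim f hf)) (h k)
          (leSucc (f k) (blim f hf) (leCocone (f k) f hf k (leSelf (f k))))))⟩,
  -- leLimit
  ⟨piSeq fun f hf => pi nat fun k => le (f k) (blim f hf),
    lam3 fun f hf k => leCocone (f k) f hf k (leSelf (f k))⟩,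
  -- succLeOfLimitLe
  ⟨piSeq fun f hf => pi nat fun k => pi brw fun x => le (blim f hf) x ⇒ le (bsucc (f k)) x,
    lam5 fun f hf k x p => tr (bsucc (f k)) (f (succ k)) x (hf k)
      (tr (f (succ k)) (blim f hf) x (leLimit f hf (succ k)) p)⟩,
  -- belowLe
  ⟨pi (brw ⇒ brw ⇒ U 0) fun c => belowZero c ⇒ belowSucc c ⇒ belowLimit c ⇒
      pi2 brw fun y z => c y z ⇒ le (bsucc z) y,
    lam4 fun c h₀ h₁ h₂ => brwInd (lam fun y => pi brw fun z => c y z ⇒ le (bsucc z) y)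
      (lam fun y => propPi brw (lam fun z => c y z ⇒ le (bsucc z) y) (lam fun z =>
        propPi (c y z) (lam fun _ => le (bsucc z) y) (lam fun _ => leProp (bsucc z) y)))
      (lam2 fun z e => emptyElim 0 (lam fun _ => le (bsucc z) bzero) (h₀ z e))
      (lam4 fun y _ z e => leSucc z y (h₁ y z e))
      (lam5 fun f hf h z e => exElim (fun n => c (f n) z) (le (bsucc z) (blim f hf))
        (leProp (bsucc z) (blim f hf)) (h₂ f hf z e)
        (fun n w => leCocone (bsucc z) f hf n (h n z w)))⟩,
  -- belowSpec: later proofs get the relation `<` from here, as a variable, so that its definition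
  -- is not unfolded again and again
  ⟨pi (U 0) fun G => (pi (brw ⇒ brw ⇒ U 0) fun c => belowZero c ⇒ belowSucc c ⇒ belowLimit c ⇒
      (pi2 brw fun x y => le (bsucc x) y ⇒ c y x) ⇒ G) ⇒ G,
    lam2 fun _ k => k (lam2 fun y z => below y z) (lam2 fun _ e => e) (lam3 fun _ _ e => e)
      (lam4 fun _ _ _ e => e) (lam3 fun x y p => belowOfLe (bsucc x) y p x (leSelf x))⟩,
  -- succLeZero
  ⟨pi brw fun x => le (bsucc x) bzero ⇒ empty,
    lam2 fun x p => belowSpec empty (lam5 fun _ h₀ _ _ h => h₀ x (h x bzero p))⟩,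
  -- succLeSucc
  ⟨pi2 brw fun x y => le (bsucc x) (bsucc y) ⇒ le x y,
    lam3 fun x y p => belowSpec (le x y) (lam5 fun _ _ h₁ _ h => h₁ y x (h x (bsucc y) p))⟩,
  -- succLeLimit
  ⟨pi brw fun x => piSeq fun f hf => le (bsucc x) (blim f hf) ⇒ ex fun n => le (bsucc x) (f n),
    lam4 fun x f hf p =>
      let goal := ex fun n => le (bsucc x) (f n)
      belowSpec goal (lam5 fun c h₀ h₁ h₂ h => exElim (fun n => c (f n) x) goal
        (truncEq 0 (sigma 0 nat (lam fun n => le (bsucc x) (f n))))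
        (h₂ f hf x (h x (blim f hf) p))
        (fun n w => exIntro (fun n => le (bsucc x) (f n)) n (belowLe c h₀ h₁ h₂ (f n) x w)))⟩,
  -- leOfSuccLe
  ⟨pi2 brw fun x y => le (bsucc x) y ⇒ le x y,
    lam3 fun x y p => tr x (bsucc x) y (leSuccSelf x) p⟩,
  -- limitLeZero
  ⟨piSeq fun f hf => le (blim f hf) bzero ⇒ empty,
    lam3 fun f hf p => succLeZero (f zero) (succLeOfLimitLe f hf zero bzero p)⟩,
  -- limitLeSucc
  ⟨piSeq fun f hf => pi brw fun x => le (blim f hf) (bsucc x) ⇒ le (blim f hf) x,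
    lam4 fun f hf x p => leLimiting f hf x (lam fun k =>
      succLeSucc (f k) x (succLeOfLimitLe f hf k (bsucc x) p))⟩,
  -- succSuccLeLimit
  ⟨pi brw fun x => piSeq fun f hf => le (bsucc x) (blim f hf) ⇒ le (bsucc (bsucc x)) (blim f hf),
    lam4 fun x f hf p => exElim (fun n => le (bsucc x) (f n)) (le (bsucc (bsucc x)) (blim f hf))
      (leProp (bsucc (bsucc x)) (blim f hf)) (succLeLimit x f hf p)
      (fun n w => tr (bsucc (bsucc x)) (bsucc (f n)) (blim f hf) (leSucc (bsucc x) (f n) w)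
        (leCocone (bsucc (f n)) f hf (succ n) (hf n)))⟩,
  -- simulatedOfLe
  ⟨piSeq fun f hf => piSeq fun g hg => le (blim f hf) (blim g hg) ⇒ simulated f g,
    lam4 fun f hf g hg => lam2 fun p n =>
      exElim (fun m => le (bsucc (f n)) (g m)) (ex fun m => le (f n) (g m))
        (truncEq 0 (sigma 0 nat (lam fun m => le (f n) (g m))))
        (succLeLimit (f n) g hg (succLeOfLimitLe f hf n (blim g hg) p))
        (fun m w => exIntro (fun m => le (f n) (g m)) m (leOfSuccLe (f n) (g m) w))⟩,
  -- eqZero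
  ⟨pi brw fun x => le x bzero ⇒ idt 0 brw bzero x,
    brwInd (lam fun x => le x bzero ⇒ idt 0 brw bzero x)
      (lam fun x => propPi (le x bzero) (lam fun _ => idt 0 brw bzero x)
        (lam fun _ => brwSet bzero x))
      (lam fun _ => refl 0 brw bzero)
      (lam3 fun x _ p => emptyElim 0 (lam fun _ => idt 0 brw bzero (bsucc x)) (succLeZero x p))
      (lam4 fun f hf _ p => emptyElim 0 (lam fun _ => idt 0 brw bzero (blim f hf))
        (limitLeZero f hf p))⟩,
  -- succNotLimit
  ⟨pi brw fun x => piSeq fun f hf => le (bsucc x) (blim f hf) ⇒ le (blim f hf) (bsucc x) ⇒ empty,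
    let irrefl := brwInd (lam fun x => le (bsucc x) x ⇒ empty)
      (lam fun x => propPi (le (bsucc x) x) (lam fun _ => empty) (lam3 fun _ x y =>
        emptyElim 0 (lam fun _ => idt 0 empty x y) x))
      (succLeZero bzero)
      (lam3 fun x h p => h (succLeSucc (bsucc x) x p))
      (lam4 fun f hf h p => exElim (fun n => le (bsucc (blim f hf)) (f n)) empty
        (lam2 fun x y => emptyElim 0 (lam fun _ => idt 0 empty x y) x)
        (succLeLimit (blim f hf) f hf p)
        (fun n w => h n (tr (bsucc (f n)) (bsucc (blim f hf)) (f n)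
          (leSucc (f n) (blim f hf) (leLimit f hf n)) w)))
    lam5 fun x f hf p q => irrefl x (tr (bsucc x) (blim f hf) x p (limitLeSucc f hf x q))⟩,
  -- antisymm
  ⟨pi2 brw fun x y => le x y ⇒ le y x ⇒ idt 0 brw x y,
    let goal (x y : Exp) : Exp := le x y ⇒ le y x ⇒ idt 0 brw x y
    let goalProp (x y : Exp) : Exp :=
      propPi (le x y) (lam fun _ => le y x ⇒ idt 0 brw x y) (lam fun _ =>
        propPi (le y x) (lam fun _ => idt 0 brw x y) (lam fun _ => brwSet x y))
    let absurd (x y e : Exp) : Exp := emptyElim 0 (lam fun _ => idt 0 brw x y) e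
    brwInd (lam fun x => pi brw fun y => goal x y)
      (lam fun x => propPi brw (lam fun y => goal x y) (lam fun y => goalProp x y))
      (lam3 fun y _ q => eqZero y q)
      (lam2 fun x h => brwInd (lam fun y => goal (bsucc x) y) (lam fun y => goalProp (bsucc x) y)
        (lam2 fun p _ => absurd (bsucc x) bzero (succLeZero x p))
        (lam4 fun y _ p q => pathElim 0 0 brw
          (lam3 fun x y _ => idt 0 brw (bsucc x) (bsucc y)) (lam fun x => refl 0 brw (bsucc x))
          x y (h y (succLeSucc x y p) (succLeSucc y x q)))
        (lam5 fun g hg _ p q => absurd (bsucc x) (blim g hg) (succNotLimit x g hg p q)))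
      (lam3 fun f hf _ => brwInd (lam fun y => goal (blim f hf) y)
        (lam fun y => goalProp (blim f hf) y)
        (lam2 fun p _ => absurd (blim f hf) bzero (limitLeZero f hf p))
        (lam4 fun y _ p q => absurd (blim f hf) (bsucc y) (succNotLimit y f hf q p))
        (lam5 fun g hg _ p q => bisim f hf g hg (simulatedOfLe f hf g hg p)
          (simulatedOfLe g hg f hf q)))⟩]

end

section

open Exp HoTT.Const Lem

local infixr:60 " ⇒ " => Exp.arrow

/-! ### The largest limit below two ordinals -/

/-- The sum of two natural numbers. -/
def addNat (n m : Exp) : Exp := natElim 0 (lam fun _ => nat) n (lam2 fun _ k => succ k) m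

/-- The limits that are at most `x` and at most `y` are at most `z`. -/
def commonBound (x y z : Exp) : Exp := piSeq fun h hh =>
  le (blim h hh) x ⇒ le (blim h hh) y ⇒ le (blim h hh) z

/-- The ordinal `z` is at most each upper bound of the limits that are at most `x` and `y`. -/
def leastBound (x y z : Exp) : Exp := pi brw fun w => commonBound x y w ⇒ le z w

/-- The ordinal `z` is the supremum of the limits that are at most `x` and at most `y`. -/
def isMeet (x y z : Exp) : Exp := prod 0 (commonBound x y z) (leastBound x y z)

/-- The limits that are at most `x` and at most `y` have a supremum. -/
def hasMeet (x y : Exp) : Exp := sigma 0 brw (lam fun z => isMeet x y z)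

/-- An element of `hasMeet x y`. -/
def mkMeet (x y z u v : Exp) : Exp :=
  pair 0 brw (lam fun z => isMeet x y z) z (mkProd 0 (commonBound x y z) (leastBound x y z) u v)

/-- The quantification over two strictly increasing sequences `f` and `g` and a sequence `z` of
suprema of the limits that are at most `f n` and `g n`. -/
def piMeets (B : (f hf g hg z hz : Exp) → Exp) : Exp :=
  piSeq fun f hf => piSeq fun g hg => pi (nat ⇒ brw) fun z =>
    pi (pi nat fun n => isMeet (f n) (g n) (z n)) fun hz => B f hf g hg z hz

/-- The sequence of the ordinals `z n + n`. -/
def sumSeq (z : Exp) : Exp := lam fun n => plus (z n) n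

/-- The supremum of the limits that are at most `x` and at most `y`. -/
def meetOf (x y : Exp) : Exp := fst 0 brw (lam fun z => isMeet x y z) (meet x y)

/-- The proof that `meetOf x y` is that supremum. -/
def meetOfSpec (x y : Exp) : Exp := snd 0 brw (lam fun z => isMeet x y z) (meet x y)

/-- The sequence of the ordinals `x + n`. -/
def omegaSeq (x : Exp) : Exp := lam fun n => plus x n

/-- The proof that `omegaSeq x` is strictly increasing. -/
def omegaIncreasing (x : Exp) : Exp := lam fun n => leSelf (bsucc (plus x n))

/-- The ordinal `x + ω`. -/
def omega (x : Exp) : Exp := blim (omegaSeq x) (omegaIncreasing x)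

/-- The existence of `meetOf x y` and its properties. Each statement is preceded by its name in
`Lem`. -/
def meetDecls : List Decl := [
  -- leNext
  ⟨piSeq fun f _ => pi nat fun n => le (f n) (f (succ n)),
    lam3 fun f hf n => leOfSuccLe (f n) (f (succ n)) (hf n)⟩,
  -- plusMono
  ⟨pi2 brw fun x y => le x y ⇒ pi nat fun n => le (plus x n) (plus y n),
    lam3 fun x y p => natElim 0 (lam fun n => le (plus x n) (plus y n)) p
      (lam2 fun n h => leSucc (plus x n) (plus y n) h)⟩,
  -- lePlus
  ⟨pi brw fun x => pi nat fun n => le x (plus x n),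
    lam fun x => natElim 0 (lam fun n => le x (plus x n)) (leSelf x)
      (lam2 fun n h => tr x (plus x n) (bsucc (plus x n)) h (leSuccSelf (plus x n)))⟩,
  -- plusLeLimit
  ⟨pi brw fun x => piSeq fun f hf => le (bsucc x) (blim f hf) ⇒ pi nat fun n =>
      le (bsucc (plus x n)) (blim f hf),
    lam4 fun x f hf p => natElim 0 (lam fun n => le (bsucc (plus x n)) (blim f hf)) p
      (lam2 fun n h => succSuccLeLimit (plus x n) f hf h)⟩,
  -- zeroLeIndex
  ⟨piSeq fun f _ => pi nat fun n => le (f zero) (f n),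
    lam2 fun f hf => natElim 0 (lam fun n => le (f zero) (f n)) (leSelf (f zero))
      (lam2 fun n h => tr (f zero) (f n) (f (succ n)) h (leNext f hf n))⟩,
  -- leIndexLeft
  ⟨pi nat fun n => pi nat fun m => piSeq fun f _ => le (f n) (f (addNat n m)),
    lam4 fun n m f hf => natElim 0 (lam fun m => le (f n) (f (addNat n m))) (leSelf (f n))
      (lam2 fun m h => tr (f n) (f (addNat n m)) (f (succ (addNat n m))) h
        (leNext f hf (addNat n m))) m⟩,
  -- leIndexRight
  ⟨pi nat fun n => pi nat fun m => piSeq fun f _ => le (f m) (f (addNat n m)),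
    lam fun n => natElim 0 (lam fun m => piSeq fun f _ => le (f m) (f (addNat n m)))
      (lam2 fun f hf => zeroLeIndex f hf n)
      (lam4 fun _ h f hf => h (lam fun k => f (succ k)) (lam fun k => hf (succ k)))⟩,
  -- commonProp
  ⟨pi3 brw fun x y z => isProp 0 (commonBound x y z),
    lam3 fun x y z =>
      let bound (h hh : Exp) : Exp :=
        le (blim h hh) x ⇒ le (blim h hh) y ⇒ le (blim h hh) z
      propPi (nat ⇒ brw) (lam fun h => pi (increasing h) fun hh => bound h hh) (lam fun h =>
        propPi (increasing h) (lam fun hh => bound h hh) (lam fun hh =>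
          propPi (le (blim h hh) x) (lam fun _ => le (blim h hh) y ⇒ le (blim h hh) z) (lam fun _ =>
            propPi (le (blim h hh) y) (lam fun _ => le (blim h hh) z) (lam fun _ =>
              leProp (blim h hh) z))))⟩,
  -- meetBound
  ⟨pi3 brw fun x y z => isMeet x y z ⇒ commonBound x y z,
    lam4 fun x y z s => prodFst 0 (commonBound x y z) (leastBound x y z) s⟩,
  -- meetLeast
  ⟨pi3 brw fun x y z => isMeet x y z ⇒ leastBound x y z,
    lam4 fun x y z s => prodSnd 0 (commonBound x y z) (leastBound x y z) s⟩,
  -- meetProp: by antisymmetry a supremum is unique, so that no choice is needed to obtain the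
  -- suprema for all members of two sequences
  ⟨pi2 brw fun x y => isProp 0 (hasMeet x y),
    lam2 fun x y => propSigma brw (lam fun z => isMeet x y z)
      (lam fun z => propProd (commonBound x y z) (leastBound x y z) (commonProp x y z)
        (propPi brw (lam fun w => commonBound x y w ⇒ le z w) (lam fun w =>
          propPi (commonBound x y w) (lam fun _ => le z w) (lam fun _ => leProp z w))))
      (lam4 fun z z' s s' => antisymm z z'
        (meetLeast x y z s z' (meetBound x y z' s'))
        (meetLeast x y z' s' z (meetBound x y z s)))⟩,
  -- meetZero
  ⟨pi brw fun y => hasMeet bzero y,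
    lam fun y => mkMeet bzero y bzero (lam4 fun _ _ p _ => p) (lam2 fun w _ => leZero w)⟩,
  -- meetSucc
  ⟨pi2 brw fun x y => hasMeet x y ⇒ hasMeet (bsucc x) y,
    lam3 fun x y t => sigmaElim 0 0 brw (lam fun z => isMeet x y z)
      (lam fun _ => hasMeet (bsucc x) y)
      (lam2 fun z s => mkMeet (bsucc x) y z
        (lam4 fun h hh p q => meetBound x y z s h hh (limitLeSucc h hh x p) q)
        (lam2 fun w u => meetLeast x y z s w (lam4 fun h hh p q =>
          u h hh (tr (blim h hh) x (bsucc x) p (leSuccSelf x)) q))) t⟩,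
  -- meetSymm
  ⟨pi2 brw fun x y => hasMeet x y ⇒ hasMeet y x,
    lam3 fun x y t => sigmaElim 0 0 brw (lam fun z => isMeet x y z) (lam fun _ => hasMeet y x)
      (lam2 fun z s => mkMeet y x z
        (lam4 fun h hh p q => meetBound x y z s h hh q p)
        (lam2 fun w u => meetLeast x y z s w (lam4 fun h hh p q => u h hh q p))) t⟩,
  -- sumIncreasing
  ⟨piMeets fun _ _ _ _ z _ => increasing (sumSeq z),
    lam6 fun f hf g hg z hz => lam fun n =>
      leSucc (plus (z n) n) (plus (z (succ n)) n) (plusMono (z n) (z (succ n))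
        (meetLeast (f n) (g n) (z n) (hz n) (z (succ n)) (lam4 fun h hh p q =>
          meetBound (f (succ n)) (g (succ n)) (z (succ n)) (hz (succ n)) h hh
            (tr (blim h hh) (f n) (f (succ n)) p (leNext f hf n))
            (tr (blim h hh) (g n) (g (succ n)) q (leNext g hg n)))) n)⟩,
  -- leSum
  ⟨piMeets fun f _ g _ z _ => pi nat fun n => pi brw fun x => le x (f n) ⇒ le x (g n) ⇒
      ex fun j => le x (plus (z j) j),
    lam6 fun f hf g hg z hz => lam fun n =>
      let goal (x : Exp) : Exp := ex fun j => le x (plus (z j) j)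
      let goalProp (x : Exp) : Exp := truncEq 0 (sigma 0 nat (lam fun j => le x (plus (z j) j)))
      let intro (x j p : Exp) : Exp := exIntro (fun j => le x (plus (z j) j)) j p
      brwInd (lam fun x => le x (f n) ⇒ le x (g n) ⇒ goal x)
        (lam fun x => propPi (le x (f n)) (lam fun _ => le x (g n) ⇒ goal x) (lam fun _ =>
          propPi (le x (g n)) (lam fun _ => goal x) (lam fun _ => goalProp x)))
        (lam2 fun _ _ => intro bzero n (leZero (plus (z n) n)))
        (lam4 fun x h p q => exElim (fun j => le x (plus (z j) j)) (goal (bsucc x))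
          (goalProp (bsucc x)) (h (leOfSuccLe x (f n) p) (leOfSuccLe x (g n) q))
          (fun j w => intro (bsucc x) (succ j)
            (tr (bsucc x) (bsucc (plus (z j) j)) (plus (z (succ j)) (succ j))
              (leSucc x (plus (z j) j) w) (sumIncreasing f hf g hg z hz j))))
        (lam5 fun h hh _ p q => intro (blim h hh) n
          (tr (blim h hh) (z n) (plus (z n) n)
            (meetBound (f n) (g n) (z n) (hz n) h hh p q) (lePlus (z n) n)))⟩,
  -- meetLimits: the summand `n` makes the sequence of suprema strictly increasing
  ⟨piMeets fun f hf g hg _ _ => hasMeet (blim f hf) (blim g hg),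
    lam6 fun f hf g hg z hz =>
      let s := sumSeq z
      let hs := sumIncreasing f hf g hg z hz
      let lim := blim s hs
      -- the limit of the sequence is at most the limit of `f`, and likewise for `g`
      let le₁ (f hf le₀ : Exp) : Exp := leLimiting s hs (blim f hf) (lam fun n =>
        leOfSuccLe (plus (z n) n) (blim f hf) (plusLeLimit (z n) f hf
          (tr (bsucc (z n)) (bsucc (f n)) (blim f hf) (leSucc (z n) (f n) (le₀ n))
            (leCocone (bsucc (f n)) f hf (succ n) (hf n))) n))
      let leF := le₁ f hf (lam fun n =>
        meetLeast (f n) (g n) (z n) (hz n) (f n) (lam4 fun _ _ p _ => p))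
      let leG := le₁ g hg (lam fun n =>
        meetLeast (f n) (g n) (z n) (hz n) (g n) (lam4 fun _ _ _ q => q))
      mkMeet (blim f hf) (blim g hg) lim
        (lam4 fun h hh p q => leLimiting h hh lim (lam fun k =>
          let elim (B : Exp → Exp) (t : Exp) (c : Exp → Exp → Exp) : Exp :=
            exElim B (le (h k) lim) (leProp (h k) lim) t c
          elim (fun n => le (bsucc (h k)) (f n))
            (succLeLimit (h k) f hf (succLeOfLimitLe h hh k (blim f hf) p)) fun n a =>
          elim (fun m => le (bsucc (h k)) (g m))
            (succLeLimit (h k) g hg (succLeOfLimitLe h hh k (blim g hg) q)) fun m b =>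
          elim (fun j => le (h k) (plus (z j) j))
            (leSum f hf g hg z hz (addNat n m) (h k)
              (tr (h k) (f n) (f (addNat n m)) (leOfSuccLe (h k) (f n) a) (leIndexLeft n m f hf))
              (tr (h k) (g m) (g (addNat n m)) (leOfSuccLe (h k) (g m) b)
                (leIndexRight n m g hg))) fun j c =>
          leCocone (h k) s hs j c))
        (lam2 fun _ u => u s hs leF leG)⟩,
  -- meet
  ⟨pi2 brw fun x y => hasMeet x y,
    brwInd (lam fun x => pi brw fun y => hasMeet x y)
      (lam fun x => propPi brw (lam fun y => hasMeet x y) (lam fun y => meetProp x y))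
      meetZero (lam3 fun x h y => meetSucc x y (h y))
      (lam3 fun f hf h =>
        let x := blim f hf
        brwInd (lam fun y => hasMeet x y) (lam fun y => meetProp x y)
          (meetSymm bzero x (meetZero x))
          (lam2 fun y t => meetSymm (bsucc y) x (meetSucc y x (meetSymm x y t)))
          (lam3 fun g hg _ =>
            let isMeet' (n : Exp) : Exp := lam fun z => isMeet (f n) (g n) z
            meetLimits f hf g hg (lam fun n => fst 0 brw (isMeet' n) (h n (g n)))
              (lam fun n => snd 0 brw (isMeet' n) (h n (g n)))))⟩,
  -- meetLeLeft
  ⟨pi2 brw fun x y => le (meetOf x y) x,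
    lam2 fun x y => meetLeast x y (meetOf x y) (meetOfSpec x y) x (lam4 fun _ _ p _ => p)⟩,
  -- meetLeRight
  ⟨pi2 brw fun x y => le (meetOf x y) y,
    lam2 fun x y => meetLeast x y (meetOf x y) (meetOfSpec x y) y (lam4 fun _ _ _ q => q)⟩,
  -- limitLeMeet
  ⟨pi2 brw fun x y => commonBound x y (meetOf x y),
    lam2 fun x y => meetBound x y (meetOf x y) (meetOfSpec x y)⟩,
  -- omegaMono
  ⟨pi2 brw fun x y => le x y ⇒ le (omega x) (omega y),
    lam3 fun x y p => leLimiting (omegaSeq x) (omegaIncreasing x) (omega y) (lam fun n =>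
      leCocone (plus x n) (omegaSeq y) (omegaIncreasing y) n (plusMono x y p n))⟩,
  -- omegaLeLimit
  ⟨pi brw fun x => piSeq fun f hf => le (bsucc x) (blim f hf) ⇒ le (omega x) (blim f hf),
    lam4 fun x f hf p => leLimiting (omegaSeq x) (omegaIncreasing x) (blim f hf) (lam fun n =>
      leOfSuccLe (plus x n) (blim f hf) (plusLeLimit x f hf p n))⟩,
  -- succLeOmega
  ⟨pi brw fun x => le (bsucc x) (omega x),
    lam fun x => leLimit (omegaSeq x) (omegaIncreasing x) (succ zero)⟩,
  -- limitLeOfOmega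
  ⟨piSeq fun f hf => pi brw fun x => le (bsucc (blim f hf)) (omega x) ⇒ le (blim f hf) x,
    lam4 fun f hf x p =>
      let lim := blim f hf
      exElim (fun n => le (bsucc lim) (plus x n)) (le lim x) (leProp lim x)
        (succLeLimit lim (omegaSeq x) (omegaIncreasing x) p) fun n w =>
          natElim 0 (lam fun n => le lim (plus x n) ⇒ le lim x) (lam fun q => q)
            (lam3 fun n h q => h (limitLeSucc f hf (plus x n) q)) n
            (leOfSuccLe lim (plus x n) w)⟩]

/-! ### Conjunction -/

/-- The proposition `α ≤ z` is equivalent to the conjunction of `α ≤ x` and `α ≤ y`. -/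
def isConj (α x y z : Exp) : Exp :=
  prod 0 (le α z ⇒ prod 0 (le α x) (le α y)) (le α x ⇒ le α y ⇒ le α z)

/-- The conjunction of `α ≤ x` and `α ≤ y` is `α`-decidable. -/
def conjDec (α x y : Exp) : Exp := exist 0 brw fun z => isConj α x y z

/-- The proof that `conjDec α x y` is a proposition. -/
def conjDecProp (α x y : Exp) : Exp := truncEq 0 (sigma 0 brw (lam fun z => isConj α x y z))

/-- The conjunction of `α ≤ x` and `α ≤ y` is `α`-decidable. Each statement is preceded by its name
in `Lem`. -/
def conjDecls : List Decl := [
  -- decIntro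
  ⟨pi3 brw fun α x y => pi brw fun z => (le α z ⇒ le α x) ⇒ (le α z ⇒ le α y) ⇒
      (le α x ⇒ le α y ⇒ le α z) ⇒ conjDec α x y,
    lam4 fun α x y z => lam3 fun u v w => truncIn 0 (sigma 0 brw (lam fun z => isConj α x y z))
      (pair 0 brw (lam fun z => isConj α x y z) z
        (mkProd 0 (le α z ⇒ prod 0 (le α x) (le α y)) (le α x ⇒ le α y ⇒ le α z)
          (lam fun p => mkProd 0 (le α x) (le α y) (u p) (v p)) w))⟩,
  -- decElim
  ⟨pi3 brw fun α x y => pi (U 0) fun G => isProp 0 G ⇒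
      (pi brw fun z => (le α z ⇒ le α x) ⇒ (le α z ⇒ le α y) ⇒ (le α x ⇒ le α y ⇒ le α z) ⇒ G) ⇒
      conjDec α x y ⇒ G,
    lam6 fun α x y G hG k =>
      truncElim 0 0 (sigma 0 brw (lam fun z => isConj α x y z)) (lam fun _ => G) (lam fun _ => hG)
        (sigmaElim 0 0 brw (lam fun z => isConj α x y z) (lam fun _ => G)
          (lam fun z => sigmaElim 0 0 (le α z ⇒ prod 0 (le α x) (le α y))
            (lam fun _ => le α x ⇒ le α y ⇒ le α z) (lam fun _ => G)
            (lam2 fun u w => k z (lam fun p => prodFst 0 (le α x) (le α y) (u p))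
              (lam fun p => prodSnd 0 (le α x) (le α y) (u p)) w)))⟩,
  -- decSymm
  ⟨pi3 brw fun α x y => conjDec α x y ⇒ conjDec α y x,
    lam3 fun α x y => decElim α x y (conjDec α y x) (conjDecProp α y x)
      (lam4 fun z u v w => decIntro α y x z v u (lam2 fun p q => w q p))⟩,
  -- decZeroLeft
  ⟨pi2 brw fun α y => conjDec α bzero y,
    lam2 fun α y => decIntro α bzero y bzero (lam fun p => p)
      (lam fun p => tr α bzero y p (leZero y)) (lam2 fun p _ => p)⟩,
  -- decMixed: for a limit `α` the conjunction is equivalent to `α + 1 ≤ x + ω` and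
  -- `α + 1 ≤ limit g`, that is, to an inequality on the limits `x + ω` and `limit g`
  ⟨pi brw fun α => (pi2 brw fun x y => conjDec α x y) ⇒ pi brw fun x => piSeq fun g hg =>
      conjDec (bsucc α) (bsucc x) (blim g hg),
    let goal (α x g hg : Exp) : Exp := conjDec (bsucc α) (bsucc x) (blim g hg)
    let goalProp (α x g hg : Exp) : Exp := conjDecProp (bsucc α) (bsucc x) (blim g hg)
    let all (α : Exp) : Exp := pi2 brw fun x y => conjDec α x y
    brwInd (lam fun α => all α ⇒ pi brw fun x => piSeq fun g hg => goal α x g hg)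
      (lam fun α => propPi (all α) (lam fun _ => pi brw fun x => piSeq fun g hg => goal α x g hg)
        (lam fun _ => propPi brw (lam fun x => piSeq fun g hg => goal α x g hg) (lam fun x =>
          propPi (nat ⇒ brw) (lam fun g => pi (increasing g) fun hg => goal α x g hg) (lam fun g =>
            propPi (increasing g) (lam fun hg => goal α x g hg) (lam fun hg =>
              goalProp α x g hg)))))
      (lam4 fun _ x g hg => decIntro (bsucc bzero) (bsucc x) (blim g hg) (blim g hg)
        (lam fun _ => leSucc bzero x (leZero x)) (lam fun p => p) (lam2 fun _ q => q))
      (lam6 fun α _ h x g hg =>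
        decElim (bsucc α) x (blim g hg) (goal (bsucc α) x g hg) (goalProp (bsucc α) x g hg)
          (lam4 fun z u v w => decIntro (bsucc (bsucc α)) (bsucc x) (blim g hg) (bsucc z)
            (lam fun p => leSucc (bsucc α) x (u (succLeSucc (bsucc α) z p)))
            (lam fun p => succSuccLeLimit α g hg (v (succLeSucc (bsucc α) z p)))
            (lam2 fun p q => leSucc (bsucc α) z
              (w (succLeSucc (bsucc α) x p) (leOfSuccLe (bsucc α) (blim g hg) q))))
          (h x (blim g hg)))
      (lam5 fun f hf _ _ x => lam2 fun g hg =>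
        let lim := blim f hf
        let z := meetOf (omega x) (blim g hg)
        decIntro (bsucc lim) (bsucc x) (blim g hg) z
          (lam fun p => leSucc lim x (limitLeOfOmega f hf x
            (tr (bsucc lim) z (omega x) p (meetLeLeft (omega x) (blim g hg)))))
          (lam fun p => tr (bsucc lim) z (blim g hg) p (meetLeRight (omega x) (blim g hg)))
          (lam2 fun p q => tr (bsucc lim) (omega lim) z (succLeOmega lim)
            (limitLeMeet (omega x) (blim g hg) (omegaSeq lim) (omegaIncreasing lim)
              (omegaMono lim x (succLeSucc lim x p)) (omegaLeLimit lim g hg q))))⟩,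
  -- decSucc: two limits are above `α + 1` if and only if they are above `α + ω`
  ⟨pi brw fun α => (pi2 brw fun x y => conjDec α x y) ⇒ pi2 brw fun x y => conjDec (bsucc α) x y,
    lam2 fun α h =>
      let β := bsucc α
      let cases (x z s l : Exp) : Exp :=
        brwInd (lam fun y => conjDec β x y) (lam fun y => conjDecProp β x y) z s l
      brwInd (lam fun x => pi brw fun y => conjDec β x y)
        (lam fun x => propPi brw (lam fun y => conjDec β x y) (lam fun y => conjDecProp β x y))
        (decZeroLeft β)
        (lam2 fun x _ => cases (bsucc x) (decSymm β bzero (bsucc x) (decZeroLeft β (bsucc x)))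
          (lam2 fun y _ => decElim α x y (conjDec β (bsucc x) (bsucc y))
            (conjDecProp β (bsucc x) (bsucc y))
            (lam4 fun z u v w => decIntro β (bsucc x) (bsucc y) (bsucc z)
              (lam fun p => leSucc α x (u (succLeSucc α z p)))
              (lam fun p => leSucc α y (v (succLeSucc α z p)))
              (lam2 fun p q => leSucc α z (w (succLeSucc α x p) (succLeSucc α y q))))
            (h x y))
          (lam3 fun g hg _ => decMixed α h x g hg))
        (lam3 fun f hf _ => cases (blim f hf)
          (decSymm β bzero (blim f hf) (decZeroLeft β (blim f hf)))
          (lam2 fun y _ => decSymm β (bsucc y) (blim f hf) (decMixed α h y f hf))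
          (lam3 fun g hg _ =>
            let x := blim f hf
            let y := blim g hg
            let z := meetOf x y
            decIntro β x y z (lam fun p => tr β z x p (meetLeLeft x y))
              (lam fun p => tr β z y p (meetLeRight x y))
              (lam2 fun p q => tr β (omega α) z (succLeOmega α)
                (limitLeMeet x y (omegaSeq α) (omegaIncreasing α)
                  (omegaLeLimit α f hf p) (omegaLeLimit α g hg q)))))⟩,
  -- dec
  ⟨pi3 brw fun α x y => conjDec α x y,
    brwInd (lam fun α => pi2 brw fun x y => conjDec α x y)
      (lam fun α => propPi brw (lam fun x => pi brw fun y => conjDec α x y) (lam fun x =>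
        propPi brw (lam fun y => conjDec α x y) (lam fun y => conjDecProp α x y)))
      (lam2 fun x y => decIntro bzero x y bzero (lam fun _ => leZero x) (lam fun _ => leZero y)
        (lam2 fun _ _ => leZero bzero))
      decSucc
      (lam5 fun f hf _ x y =>
        let α := blim f hf
        let z := meetOf x y
        decIntro α x y z (lam fun p => tr α z x p (meetLeLeft x y))
          (lam fun p => tr α z y p (meetLeRight x y))
          (lam2 fun p q => limitLeMeet x y f hf p q))⟩]

end

/-! ### The closed element -/

section

open Exp HoTT.Const Lem

local infixr:60 " ⇒ " => Exp.arrow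

/-- For all ordinals `α`, `x`, `y`, the conjunction of `α ≤ x` and `α ≤ y` is `α`-decidable. -/
def conjDecAll : Exp := pi3 brw fun α x y => conjDec α x y

/-- The proof that `α`-decidable propositions in `U i` are closed under conjunction, from an
element `h` of `conjDecAll`. -/
def conjunctionProof (i : ℕ) (h : Exp) : Exp := lam5 fun α P Q _ _ => lam2 fun dP dQ =>
  let witness (P : Exp) : Exp := lam fun y => iff i P (le α y)
  let goal := ordDecidable i α (prod i P Q)
  let goalProp := truncEq i (sigma i brw (witness (prod i P Q)))
  let elim (j : ℕ) (B t : Exp) (k : Exp → Exp → Exp) : Exp :=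
    truncElim j i (sigma j brw B) (lam fun _ => goal) (lam fun _ => goalProp)
      (lam fun s => sigmaElim j i brw B (lam fun _ => goal) (lam2 k) s) t
  let mp (P y e p : Exp) : Exp := prodFst i (P ⇒ le α y) (le α y ⇒ P) e p
  let mpr (P y e p : Exp) : Exp := prodSnd i (P ⇒ le α y) (le α y ⇒ P) e p
  elim i (witness P) dP fun x e =>
  elim i (witness Q) dQ fun y e' =>
  elim 0 (lam fun z => isConj α x y z) (h α x y) fun z c =>
    let both (p : Exp) : Exp :=
      prodFst 0 (le α z ⇒ prod 0 (le α x) (le α y)) (le α x ⇒ le α y ⇒ le α z) c p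
    truncIn i (sigma i brw (witness (prod i P Q))) (pair i brw (witness (prod i P Q)) z
      (mkProd i (prod i P Q ⇒ le α z) (le α z ⇒ prod i P Q)
        (lam fun p =>
          prodSnd 0 (le α z ⇒ prod 0 (le α x) (le α y)) (le α x ⇒ le α y ⇒ le α z) c
            (mp P x e (prodFst i P Q p)) (mp Q y e' (prodSnd i P Q p)))
        (lam fun p => mkProd i P Q (mpr P x e (prodFst 0 (le α x) (le α y) (both p)))
          (mpr Q y e' (prodSnd 0 (le α x) (le α y) (both p))))))

/-- The constants of the development, in an order in which their types can be checked. -/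
def constants : List Const :=
  [.brw, .idt 0, .le, .bsucc, .nat, .succ, .bzero, .zero, .blim, .leZero, .leTrans, .leSucc,
    .leCocone, .leLimiting, .leProp, .sigma 0, .pair 0, .trunc 0, .trunc 1, .truncIn 1,
    .truncIn 0, .truncEq 0, .brwSet, .bisim, .idt 1, .refl 1, .refl 0, .sigma 1, .pair 1,
    .sigmaElim 1 1, .sigmaElim 1 0, .sigmaElim 0 0, .pathElim 1 1, .pathElim 1 0, .pathElim 0 1,
    .pathElim 0 0, .natElim 0, .empty, .emptyElim 0, .truncElim 1 0, .truncElim 0 0, .brwElim 1,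
    .brwElim 0, .leElim 1, .funext 1, .funext 0, .univalence 0]

/-- The constants of `conjunctionProof 0`, in an order in which their types can be checked. -/
def constants₀ : List Const :=
  [.brw, .le, .sigma 0, .pair 0, .sigmaElim 0 0, .idt 0, .trunc 0, .truncEq 0, .truncIn 0,
    .truncElim 0 0]

/-- The constants of `conjunctionProof 1`, in an order in which their types can be checked. -/
def constants₁ : List Const :=
  [.brw, .le, .sigma 1, .sigma 0, .idt 0, .idt 1, .pair 1, .pair 0, .sigmaElim 1 1,
    .sigmaElim 0 1, .sigmaElim 0 0, .trunc 1, .trunc 0, .truncEq 1, .truncIn 1, .truncIn 0,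
    .truncElim 1 1, .truncElim 0 1]

end

/-- Relative to the statement `conjDecAll`, the term `conjunctionProof j` is a proof of
`conjunctionClosure j` that uses the constants `cs` only. -/
def closureTest (cs : List Const) (j : ℕ) : Bool :=
  match sortOf (checker (memConst cs) fuel) [conjDecAll.close] ((conjunctionClosure j).toTm 1),
      checker (memConst cs) fuel [conjDecAll.close] ((conjunctionProof j (Exp.bvar 0)).toTm 1)
        (some ((conjunctionClosure j).toTm 1)) with
  | some _, some _ => true
  | _, _ => false

theorem closedBelow_conjDecAll : closedBelow 0 conjDecAll.close = true := by decide +kernel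

theorem closedBelow_conjunctionClosure (i : ℕ) :
    closedBelow 0 (conjunctionClosure i).close = true := rfl

set_option maxRecDepth 100000 in
theorem constsTest_constants : constsTest [] constants = true := by decide +kernel

set_option maxRecDepth 100000 in
theorem constsTest_constants₀ : constsTest [] constants₀ = true := by decide +kernel

set_option maxRecDepth 100000 in
theorem constsTest_constants₁ : constsTest [] constants₁ = true := by decide +kernel

set_option maxRecDepth 100000 in
theorem closureTest_zero : closureTest constants₀ 0 = true := by decide +kernel

set_option maxRecDepth 100000 in
theorem closureTest_one : closureTest constants₁ 1 = true := by decide +kernel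

set_option maxRecDepth 100000 in
theorem declsTest_logicDecls : declsTest (memConst constants) 0 [] logicDecls = true := by
  decide +kernel

set_option maxRecDepth 100000 in
theorem declsTest_orderDecls :
    declsTest (memConst constants) 21 (extend 0 [] logicDecls) orderDecls = true := by
  decide +kernel

set_option maxRecDepth 100000 in
theorem declsTest_meetDecls :
    declsTest (memConst constants) 39 (extend 21 (extend 0 [] logicDecls) orderDecls)
      meetDecls = true := by
  decide +kernel

set_option maxRecDepth 100000 in
theorem declsTest_conjDecls :
    declsTest (memConst constants) 64
      (extend 39 (extend 21 (extend 0 [] logicDecls) orderDecls) meetDecls) conjDecls = true := by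
  decide +kernel

theorem wf_and_inhabited_conjDecAll :
    (∃ i, HasType [] conjDecAll.close (univ i)) ∧ ∃ t, HasType [] t conjDecAll.close := by
  have hok := admissible_of_mem (admissible_of_constsTest (e := id) strictMono_id
    (acc := []) (fun _ hc => nomatch hc)
    (fun c _ => by rw [mapLevel_id, Const.mapLevel_id]) constsTest_constants)
  obtain ⟨Γ, hΓ, σ, hσ⟩ : ∃ Γ, Realized (conjDecAll.close :: Γ) :=
    ⟨_, (((Realized.nil.extend hok declsTest_logicDecls).extend hok declsTest_orderDecls).extend
      hok declsTest_meetDecls).extend hok declsTest_conjDecls⟩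
  have hn : Lookup (conjDecAll.close :: Γ) 0 conjDecAll.close.lift := .zero _ _
  obtain ⟨i, hi⟩ := hΓ.lookup hn
  have hσT : conjDecAll.close.lift.subst σ = conjDecAll.close := by
    rw [Tm.lift, subst_rename]
    exact subst_of_closedBelow closedBelow_conjDecAll fun _ hn => absurd hn (Nat.not_lt_zero _)
  exact ⟨⟨i, hσT ▸ hi.subst hσ⟩, _, hσT ▸ hσ _ _ hn⟩

/-- Since universe levels may be changed after the type checking, one test serves all universes
that the level `j` is mapped to. -/
theorem exists_hasType_of_closureTest {e : ℕ → ℕ} (he : StrictMono e) {cs : List Const} {j : ℕ}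
    (hcs : ∀ c ∈ cs, (constType c).close.mapLevel e = (constType (c.mapLevel e)).close)
    (hT : conjDecAll.close.mapLevel e = conjDecAll.close)
    (hc : constsTest [] cs = true) (h : closureTest cs j = true) :
    ∃ t, HasType [] t (conjunctionClosure (e j)).close := by
  obtain ⟨⟨_, hU⟩, u, hu⟩ := wf_and_inhabited_conjDecAll
  have hs := checker_sound he
    (admissible_of_mem (admissible_of_constsTest he (acc := [])
      (fun _ hc => nomatch hc) hcs hc)) fuel
  unfold closureTest at h
  split at h
  · next i T hi hT' =>
    have hΓ : WfCtx ([conjDecAll.close].map (Tm.mapLevel e)) := by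
      rw [List.map_singleton, hT]
      exact .cons .nil hU
    have ht := ((hs _ _ hΓ).2 _ _ _ (hasType_of_sortOf hs hΓ hi) hT')
    rw [List.map_singleton, hT] at ht
    have ht' := ht.inst hu
    have hcl : ((conjunctionClosure j).toTm 1).mapLevel e
      = (conjunctionClosure (e j)).close := rfl
    have hinst : (conjunctionClosure (e j)).close.inst u = (conjunctionClosure (e j)).close :=
      subst_of_closedBelow (closedBelow_conjunctionClosure (e j))
        fun _ hn => absurd hn (Nat.not_lt_zero _)
    rw [hcl, hinst] at ht'
    exact ⟨_, ht'⟩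
  · cases h

/-- The embedding of universe levels that maps `1` to `k + 1` and fixes `0`, the only level in
`conjDecAll`. -/
def shiftLevel (k : ℕ) : ℕ → ℕ
  | 0 => 0
  | n + 1 => k + n + 1

theorem strictMono_shiftLevel (k : ℕ) : StrictMono (shiftLevel k) := by
  refine strictMono_nat_of_lt_succ fun n => ?_
  cases n <;> simp only [shiftLevel] <;> omega

theorem holds_conjunctionClosure (i : ℕ) : Holds (conjunctionClosure i) := by
  cases i with
  | zero =>
    exact exists_hasType_of_closureTest strictMono_id
      (fun c _ => by rw [mapLevel_id, Const.mapLevel_id]) (mapLevel_id _)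
      constsTest_constants₀ closureTest_zero
  | succ k =>
    refine exists_hasType_of_closureTest (strictMono_shiftLevel k) ?_ rfl
      constsTest_constants₁ closureTest_one
    simp only [constants₁, List.forall_mem_cons]
    refine ⟨rfl, rfl, rfl, rfl, rfl, rfl, rfl, rfl, rfl, rfl, rfl, rfl, rfl, rfl, rfl, rfl, rfl,
      rfl, fun _ h => nomatch h⟩
end HoTT
theorem theorem5p6 (i : ℕ) : HoTT.Holds (HoTT.conjunctionClosure i) :=
  HoTT.holds_conjunctionClosure i
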